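/- A \emph{plane} is a system of points and lines such that any two distinct points lie on exactly one line, any two distinct lines have at most one common point, every line contains at least two points, and there are three non-collinear points. It is \emph{projective} if any two distinct lines have exactly one common point. A projective plane is \emph{Desarguesian} if, for all triples of distinct points $p,q,r$ and $p',q',r'$ for which the lines $p\vee p'$, $q\vee q'$, $r\vee r'$ are defined and pass through a common point, the points $(p\vee q)\wedge(p'\vee q')$, $(p\vee r)\wedge(p'\vee r')$, $(q\vee r)\wedge(q'\vee r')$, whenever they are defined (that is, $p\vee q\ne p'\vee q'$, $p\vee r\ne p'\vee r'$ and $q\vee r\ne q'\vee r'$), are collinear. Graphs are simple and undirected. Theorem. One can assign to every infinite graph $\Gamma=(V,E)$ a projective plane $P^*_\Gamma$ such that: (1) $P^*_\Gamma$ has the same size as $\Gamma$, i.e. the set of points of $P^*_\Gamma$ has cardinality $|V|$; (2) $P^*_\Gamma$ is non-Desarguesian; (3) $\mathrm{Aut}(\Gamma)\cong\mathrm{Aut}(P^*_\Gamma)$ (as groups); (4) for all infinite graphs $\Gamma_1,\Gamma_2$: $\Gamma_1\cong\Gamma_2$ if and only if $P^*_{\Gamma_1}\cong P^*_{\Gamma_2}$;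 (5) restricted to structures with domain $\omega$, the map $\Gamma\mapsto P^*_\Gamma$ is Borel. Here a plane with domain $\omega$ is a structure with domain $\omega$ in the language with unary predicates for points and lines and a binary incidence relation, and the graphs, respectively the structures in this language, with domain $\omega$ carry the topology inherited from the product of discrete two-point spaces indexed by the atomic statements about elements of $\omega$. -/

import Mathlib

universe u

/-- A structure with domain `A` in the language that has a unary predicate for points, a unary
predicate for lines and a binary relation of incidence (`inc p l`: the point `p` is on the
line `l`). -/
structure IncStr (A : Type*) where
  pt : A → Prop
  ln : A → Prop
  inc : A → A → Prop

namespace IncStr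

/-- `S` is a system of points and lines: each element of the domain is either a point or a line,
and not both, and incidence is a relation between points and lines. -/
structure IsPointLineSystem {A : Type*} (S : IncStr A) : Prop where
  pt_or_ln : ∀ x, S.pt x ∨ S.ln x
  not_both : ∀ x, ¬ (S.pt x ∧ S.ln x)
  inc_sorts : ∀ x y, S.inc x y → S.pt x ∧ S.ln y

/-- The elements `x`, `y`, `z` (meant to be points) are on a common line. -/
def Collinear {A : Type*} (S : IncStr A) (x y z : A) : Prop :=
  ∃ l, S.ln l ∧ S.inc x l ∧ S.inc y l ∧ S.inc z l

/-- Planes. -/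
structure IsPlane {A : Type*} (S : IncStr A) : Prop extends IsPointLineSystem S where
  /-- every pair of distinct points determines a unique line -/
  join : ∀ p q, S.pt p → S.pt q → p ≠ q → ∃! l, S.ln l ∧ S.inc p l ∧ S.inc q l
  /-- every pair of distinct lines intersects in at most one point -/
  meet_le_one : ∀ l m, S.ln l → S.ln m → l ≠ m →
    ∀ p q, S.inc p l → S.inc p m → S.inc q l → S.inc q m → p = q
  /-- every line contains at least two points -/
  two_points : ∀ l, S.ln l → ∃ p q, p ≠ q ∧ S.inc p l ∧ S.inc q l
  /-- there are three non-collinear points -/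
  three_points : ∃ p q r, S.pt p ∧ S.pt q ∧ S.pt r ∧ ¬ S.Collinear p q r

/-- Projective planes: planes in which any two distinct lines intersect in exactly one point. -/
structure IsProjectivePlane {A : Type*} (S : IncStr A) : Prop extends IsPlane S where
  meet : ∀ l m, S.ln l → S.ln m → l ≠ m → ∃! p, S.pt p ∧ S.inc p l ∧ S.inc p m

/-- Desargues' condition. For triples of distinct points `p, q, r` and `p', q', r'` such that the
lines `a = p ∨ p'`, `b = q ∨ q'`, `c = r ∨ r'` have a common point `o`, the intersections
`x` of `p ∨ q` and `p' ∨ q'`, `y` of `p ∨ r` and `p' ∨ r'`, `z` of `q ∨ r` and `q' ∨ r'` are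
collinear. The hypotheses `p ≠ p'`, ..., `pq ≠ pq'`, ... say that the lines `p ∨ p'`, ... and the
intersections are defined. -/
def IsDesarguesian {A : Type*} (S : IncStr A) : Prop :=
  ∀ p q r p' q' r' : A,
    p ≠ q → p ≠ r → q ≠ r → p' ≠ q' → p' ≠ r' → q' ≠ r' →
    p ≠ p' → q ≠ q' → r ≠ r' →
    ∀ a b c o : A,
      S.inc p a → S.inc p' a → S.inc q b → S.inc q' b → S.inc r c → S.inc r' c →
      S.inc o a → S.inc o b → S.inc o c →
    ∀ pq pq' pr pr' qr qr' : A,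
      S.inc p pq → S.inc q pq → S.inc p' pq' → S.inc q' pq' → pq ≠ pq' →
      S.inc p pr → S.inc r pr → S.inc p' pr' → S.inc r' pr' → pr ≠ pr' →
      S.inc q qr → S.inc r qr → S.inc q' qr' → S.inc r' qr' → qr ≠ qr' →
    ∀ x y z : A,
      S.inc x pq → S.inc x pq' → S.inc y pr → S.inc y pr' → S.inc z qr → S.inc z qr' →
      S.Collinear x y z

/-- The bijection `e` between the domains is an isomorphism of structures. -/
structure IsIso {A B : Type*} (S : IncStr A) (T : IncStr B) (e : A ≃ B) : Prop where
  pt_iff : ∀ x, T.pt (e x) ↔ S.pt x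
  ln_iff : ∀ x, T.ln (e x) ↔ S.ln x
  inc_iff : ∀ x y, T.inc (e x) (e y) ↔ S.inc x y

/-- `S` and `T` are isomorphic. -/
def Isomorphic {A B : Type*} (S : IncStr A) (T : IncStr B) : Prop :=
  ∃ e : A ≃ B, IsIso S T e

/-- The automorphism group of `S`. -/
def Aut {A : Type*} (S : IncStr A) : Subgroup (Equiv.Perm A) where
  carrier := {e | IsIso S S e}
  one_mem' := ⟨fun _ => Iff.rfl, fun _ => Iff.rfl, fun _ _ => Iff.rfl⟩
  mul_mem' := fun {e f} he hf =>
    ⟨fun x => (he.pt_iff (f x)).trans (hf.pt_iff x),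
     fun x => (he.ln_iff (f x)).trans (hf.ln_iff x),
     fun x y => (he.inc_iff (f x) (f y)).trans (hf.inc_iff x y)⟩
  inv_mem' := fun {e} he =>
    ⟨fun x => by simpa using (he.pt_iff (e⁻¹ x)).symm,
     fun x => by simpa using (he.ln_iff (e⁻¹ x)).symm,
     fun x y => by simpa using (he.inc_iff (e⁻¹ x) (e⁻¹ y)).symm⟩

/-- The topology on the structures with domain `A`: the topology of the product of the discrete
two-point spaces indexed by the atomic statements `pt x`, `ln x`, `inc x y`. -/
@[reducible] def structTopology (A : Type*) : TopologicalSpace (IncStr A) :=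
  TopologicalSpace.generateFrom
    ({U | ∃ x, U = {S | S.pt x} ∨ U = {S | ¬ S.pt x}} ∪
     {U | ∃ x, U = {S | S.ln x} ∨ U = {S | ¬ S.ln x}} ∪
     {U | ∃ x y, U = {S | S.inc x y} ∨ U = {S | ¬ S.inc x y}})

end IncStr

/-- The topology on the graphs with vertex set `V`: the subspace topology from the product of the
discrete two-point spaces indexed by the pairs of vertices. -/
@[reducible] def graphTopology (V : Type*) : TopologicalSpace (SimpleGraph V) :=
  TopologicalSpace.generateFrom
    {U | ∃ v w, U = {G : SimpleGraph V | G.Adj v w} ∨ U = {G : SimpleGraph V | ¬ G.Adj v w}}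

/-- A map from the graphs on `V` to the incidence structures on `A` is Borel. -/
def IsBorelMap {V A : Type*} (f : SimpleGraph V → IncStr A) : Prop :=
  @Measurable _ _ (@borel _ (graphTopology V)) (@borel _ (IncStr.structTopology A)) f

/-! The plane is the free completion of a configuration of points and lines that encodes `Γ`. Regard
incidence as a two-coloured graph in which distinct elements have at most one common neighbour.
Adding, again and again, a common neighbour for every two elements of equal colour that lack one
yields a projective plane (`isProjectivePlane_planeOn`). An added element has only two neighbours of
no larger rank. Hence a finite set whose members all have three neighbours inside it lies in the
original configuration: look at a member of maximal rank (`exists_ofBase_of_inConfined`). If such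
sets cover the configuration, the plane remembers it, and isomorphisms of planes are the extensions
of isomorphisms of configurations (`IsIso.exists_eq_ext`).

In the configuration of `Γ` each vertex becomes a path of eight elements of alternating colour, and
each ordered pair of distinct vertices `v`, `w` gives two incident point-line pairs tied to both
paths. One of the two lines meets position 0 of the path of `v`, the other position 2; which one
does which codes adjacency. Path elements have infinitely many neighbours and all others finitely
many, so the paths are recognisable; the two ends of a path differ in colour, so no path can be
reversed; the remaining elements are determined by the paths. Thus isomorphisms of configurations
are isomorphisms of graphs (`exists_eq_isoOf`).

Desargues' condition fails because the configuration contains two triangles in perspective whose six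
sides are all added freely, and no line passes through the three resulting intersections
(`not_collinear_of_diagonal`).

All these planes consist of terms over one set that does not depend on `Γ`; only validity and
adjacency of terms vary. For countable `V` these are Borel conditions on `Γ`, so the valid terms can
be enumerated by `V` in a Borel way (`exists_measurable_enumeration`). -/

/-- A bipartite graph, with colour classes given by `col`, in which two distinct vertices have at
most one common neighbour. -/
structure Configuration (A : Type*) where
  col : A → Bool
  adj : A → A → Prop
  symm : ∀ {a b}, adj a b → adj b a
  col_ne : ∀ {a b}, adj a b → col a ≠ col b
  unique : ∀ {a b u v}, a ≠ b → adj a u → adj b u → adj a v → adj b v → u = v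

/-! ### Terms that name the elements of a free completion -/

/-- Terms over `A`: `node s t` stands for the common neighbour of `s` and `t`. -/
inductive FTerm (A : Type u) : Type u
  | base (a : A) : FTerm A
  | node (s t : FTerm A) : FTerm A

namespace FTerm

variable {A B : Type u}

/-- The common neighbour of an unordered pair of terms, with a chosen order of the pair. -/
noncomputable def mkNode (s t : FTerm A) : FTerm A :=
  node (Quot.out s(s, t)).1 (Quot.out s(s, t)).2

theorem mkNode_comm (s t : FTerm A) : mkNode s t = mkNode t s := by
  unfold mkNode; rw [Sym2.eq_swap]

theorem mkNode_eq_or (s t : FTerm A) : mkNode s t = node s t ∨ mkNode s t = node t s := by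
  have h : s((Quot.out s(s, t)).1, (Quot.out s(s, t)).2) = s(s, t) := Quot.out_eq s(s, t)
  rw [Sym2.eq_iff] at h
  unfold mkNode
  rcases h with ⟨h1, h2⟩ | ⟨h1, h2⟩
  · left; rw [h1, h2]
  · right; rw [h1, h2]

theorem mkNode_ne_base (s t : FTerm A) (a : A) : mkNode s t ≠ base a := by
  unfold mkNode; simp

/-- The number of steps in which a term is built. -/
def rank : FTerm A → ℕ
  | base _ => 0
  | node s t => max s.rank t.rank + 1

/-- The map between terms induced by a map between the base elements. -/
noncomputable def map (f : A → B) : FTerm A → FTerm B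
  | base a => base (f a)
  | node s t => mkNode (map f s) (map f t)

theorem map_mkNode (f : A → B) (s t : FTerm A) : map f (mkNode s t) = mkNode (map f s) (map f t) := by
  rcases mkNode_eq_or s t with h | h <;> rw [h]
  · rfl
  · rw [mkNode_comm]; rfl

/-- The arities of the constructors of terms. -/
def Arity : A ⊕ PUnit.{u + 1} → Type u
  | .inl _ => PEmpty
  | .inr _ => ULift Bool

instance : ∀ x : A ⊕ PUnit.{u + 1}, Finite (Arity x)
  | .inl _ => inferInstanceAs (Finite PEmpty)
  | .inr _ => inferInstanceAs (Finite (ULift Bool))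

/-- Terms as well-founded trees. -/
def toWType : FTerm A → WType (Arity (A := A))
  | base a => ⟨.inl a, fun x => PEmpty.elim x⟩
  | node s t => ⟨.inr .unit, fun b => if ULift.down b then toWType s else toWType t⟩

theorem toWType_injective : Function.Injective (toWType (A := A)) := by
  intro s
  induction s with
  | base a =>
    rintro (b | ⟨s, t⟩) h
    · simp only [toWType, WType.mk.injEq, Sum.inl.injEq] at h
      rw [h.1]
    · simp [toWType] at h
  | node s t ihs iht =>
    rintro (b | ⟨s', t'⟩) h
    · simp [toWType] at h
    · simp only [toWType, WType.mk.injEq, heq_eq_eq, true_and] at h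
      rw [ihs (congrFun h ⟨true⟩), iht (congrFun h ⟨false⟩)]

-- Terms are finitely branching trees with labels from a set of size `#A`, so the bound for W-types
-- of finite arity applies. This keeps the plane as small as the graph.
open Cardinal in
theorem cardinal_le [Infinite A] : #(FTerm A) ≤ #A := by
  refine (Cardinal.mk_le_of_injective toWType_injective).trans
    (WType.cardinalMk_le_max_aleph0_of_finite'.trans ?_)
  have hA := Cardinal.aleph0_le_mk A
  simp [hA]

end FTerm

/-! ### The free completion: existence and uniqueness of common neighbours -/

namespace Configuration

open FTerm

variable {A B : Type u} (C : Configuration A)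

/-- The colour of a term. -/
def tcol : FTerm A → Bool
  | base a => C.col a
  | node s _ => !(tcol s)

/-- `C.lo x u`: the term `u` is a neighbour of `x` which is present when `x` is added. -/
def lo : FTerm A → FTerm A → Prop
  | base a, base b => C.adj a b
  | base _, node _ _ => False
  | node s t, u => u = s ∨ u = t

/-- The terms `s` and `t` have a common neighbour when both of them are present. -/
def Joined (s t : FTerm A) : Prop :=
  ∃ u, (C.lo s u ∧ C.lo t u) ∨ (C.lo t u ∧ C.lo u s) ∨ (C.lo s u ∧ C.lo u t)

/-- The terms which are elements of the free completion of `C`. -/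
def Valid : FTerm A → Prop
  | base _ => True
  | node s t => Valid s ∧ Valid t ∧ s ≠ t ∧ C.tcol s = C.tcol t ∧ mkNode s t = node s t ∧
      ¬ C.Joined s t

/-- Adjacency in the free completion. -/
def tadj (x y : FTerm A) : Prop := C.lo x y ∨ C.lo y x

variable {C}

theorem tadj_symm {x y : FTerm A} (h : C.tadj x y) : C.tadj y x := h.symm

theorem lo_mkNode {s t u : FTerm A} : C.lo (mkNode s t) u ↔ u = s ∨ u = t := by
  rcases mkNode_eq_or s t with h | h <;> rw [h] <;> simp [lo, or_comm]

theorem Joined.symm {s t : FTerm A} (h : C.Joined s t) : C.Joined t s := by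
  obtain ⟨u, h⟩ := h
  exact ⟨u, by tauto⟩

theorem Joined.exists_tadj {s t : FTerm A} (h : C.Joined s t) :
    ∃ u, C.tadj s u ∧ C.tadj t u ∧ (C.Valid s → C.Valid t → C.Valid u) := by
  have key : ∀ x y : FTerm A, C.lo x y → C.Valid x → C.Valid y := by
    rintro (a | ⟨s, t⟩) y h hx
    · cases y
      · trivial
      · exact h.elim
    · rcases h with rfl | rfl
      exacts [hx.1, hx.2.1]
  obtain ⟨u, ⟨h1, h2⟩ | ⟨h1, h2⟩ | ⟨h1, h2⟩⟩ := h
  · exact ⟨u, .inl h1, .inl h2, fun hs _ => key _ _ h1 hs⟩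
  · exact ⟨u, .inr h2, .inl h1, fun _ ht => key _ _ h1 ht⟩
  · exact ⟨u, .inl h1, .inr h2, fun hs _ => key _ _ h1 hs⟩

theorem valid_mkNode {s t : FTerm A} : C.Valid (mkNode s t) ↔
    C.Valid s ∧ C.Valid t ∧ s ≠ t ∧ C.tcol s = C.tcol t ∧ ¬ C.Joined s t := by
  rcases mkNode_eq_or s t with h | h
  · rw [h]; simp [Valid, h]
  · rw [h]; simp only [Valid]
    rw [mkNode_comm] at h
    have : C.Joined t s ↔ C.Joined s t := ⟨Joined.symm, Joined.symm⟩
    rw [this, eq_comm (a := C.tcol t), ne_comm]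
    tauto

theorem tcol_mkNode {s t : FTerm A} (h : C.tcol s = C.tcol t) : C.tcol (mkNode s t) = !(C.tcol s) := by
  rcases mkNode_eq_or s t with h' | h' <;> rw [h'] <;> simp [tcol, h]

theorem not_lo_node {x s t : FTerm A} (h : x.rank ≤ (node s t).rank) :
    ¬ C.lo x (node s t) := by
  rcases x with a | ⟨x, y⟩
  · exact id
  · rintro (h' | h') <;> · simp only [rank, ← h'] at h; omega

theorem lo_col_ne {x u : FTerm A} (hx : C.Valid x) (h : C.lo x u) : C.tcol x ≠ C.tcol u := by
  rcases x with a | ⟨s, t⟩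
  · cases u
    · exact C.col_ne h
    · exact h.elim
  · rcases h with rfl | rfl
    · simp [tcol]
    · simp [tcol, hx.2.2.2.1]

theorem tadj_col_ne {x y : FTerm A} (hx : C.Valid x) (hy : C.Valid y) (h : C.tadj x y) :
    C.tcol x ≠ C.tcol y :=
  h.elim (lo_col_ne hx) fun h => (lo_col_ne hy h).symm

/-- `Joined` omits only common neighbours built on top of both terms, and the only candidate for
these is the term about to be added. So when it fails, `mkNode x y` is valid and serves as the
common neighbour. -/
theorem exists_common {x y : FTerm A} (hx : C.Valid x) (hy : C.Valid y) (hne : x ≠ y)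
    (hc : C.tcol x = C.tcol y) : ∃ u, C.Valid u ∧ C.tadj x u ∧ C.tadj y u := by
  by_cases h : C.Joined x y
  · obtain ⟨u, h1, h2, h3⟩ := h.exists_tadj
    exact ⟨u, h3 hx hy, h1, h2⟩
  · exact ⟨mkNode x y, valid_mkNode.2 ⟨hx, hy, hne, hc, h⟩, .inr (lo_mkNode.2 (.inl rfl)),
      .inr (lo_mkNode.2 (.inr rfl))⟩

/-- The opposite corners of a quadrangle coincide if one of them has maximal rank. -/
theorem corner_eq {x y u v : FTerm A} (hu : C.Valid u) (hv : C.Valid v) (hne : x ≠ y)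
    (h1 : C.tadj x u) (h2 : C.tadj y u) (h3 : C.tadj x v) (h4 : C.tadj y v)
    (hx : x.rank ≤ u.rank) (hy : y.rank ≤ u.rank) (hvu : v.rank ≤ u.rank) : u = v := by
  rcases u with a | ⟨s, t⟩
  · rcases x with x | ⟨_, _⟩
    · rcases y with y | ⟨_, _⟩
      · rcases v with v | ⟨_, _⟩
        · have e : ∀ {b c : A}, C.tadj (base b) (base c) → C.adj b c :=
            fun h => h.elim id fun h => C.symm h
          rw [C.unique (fun h => hne (congrArg base h)) (e h1) (e h2) (e h3) (e h4)]
        · simp [rank] at hvu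
      · simp [rank] at hy
    · simp [rank] at hx
  · have e1 : x = s ∨ x = t := h1.resolve_left (not_lo_node hx)
    have e2 : y = s ∨ y = t := h2.resolve_left (not_lo_node hy)
    obtain ⟨-, -, -, -, hm, hj⟩ := hu
    have hj' : ¬ C.Joined x y := by
      rcases e1 with rfl | rfl <;> rcases e2 with rfl | rfl
      · exact (hne rfl).elim
      · exact hj
      · exact fun h => hj h.symm
      · exact (hne rfl).elim
    have hm' : mkNode x y = node s t := by
      rcases e1 with rfl | rfl <;> rcases e2 with rfl | rfl
      · exact (hne rfl).elim
      · exact hm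
      · rw [mkNode_comm]; exact hm
      · exact (hne rfl).elim
    -- Here `u` was added for the pair `x`, `y`, which was therefore not joined; so `v` too must lie
    -- above both of them, which makes it the same node.
    have hvx : C.lo v x := h3.resolve_left fun h => by
      rcases h4 with h4 | h4
      · exact hj' ⟨v, .inl ⟨h, h4⟩⟩
      · exact hj' ⟨v, .inr (.inr ⟨h, h4⟩)⟩
    have hvy : C.lo v y := h4.resolve_left fun h => hj' ⟨v, .inr (.inl ⟨h, hvx⟩)⟩
    rcases v with v | ⟨s', t'⟩
    · rcases x with x | ⟨_, _⟩
      · rcases y with y | ⟨_, _⟩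
        · exact (hj' ⟨base v, .inl ⟨C.symm hvx, C.symm hvy⟩⟩).elim
        · exact hvy.elim
      · exact hvx.elim
    · obtain ⟨-, -, -, -, hm2, -⟩ := hv
      rw [← hm', ← hm2]
      rcases hvx with rfl | rfl <;> rcases hvy with rfl | rfl
      · exact (hne rfl).elim
      · rfl
      · exact mkNode_comm _ _
      · exact (hne rfl).elim

/-- Some corner of the quadrangle `x`, `u`, `y`, `v` has maximal rank, and `corner_eq` identifies it
with the opposite corner. The case split only locates that corner. -/
theorem common_unique {x y u v : FTerm A} (hx : C.Valid x) (hy : C.Valid y) (hu : C.Valid u)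
    (hv : C.Valid v) (hne : x ≠ y)
    (h1 : C.tadj x u) (h2 : C.tadj y u) (h3 : C.tadj x v) (h4 : C.tadj y v) : u = v := by
  by_contra hn
  have h1' := tadj_symm h1
  have h2' := tadj_symm h2
  have h3' := tadj_symm h3
  have h4' := tadj_symm h4
  rcases le_total x.rank y.rank with a | a <;> rcases le_total u.rank v.rank with b | b
  · rcases le_total y.rank v.rank with c | c
    · exact hn (corner_eq hv hu hne h3 h4 h1 h2 (a.trans c) c b).symm
    · exact hne (corner_eq hy hx hn h2' h4' h1' h3' (b.trans c) c a).symm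
  · rcases le_total y.rank u.rank with c | c
    · exact hn (corner_eq hu hv hne h1 h2 h3 h4 (a.trans c) c b)
    · exact hne (corner_eq hy hx hn h2' h4' h1' h3' c (b.trans c) a).symm
  · rcases le_total x.rank v.rank with c | c
    · exact hn (corner_eq hv hu hne h3 h4 h1 h2 c (a.trans c) b).symm
    · exact hne (corner_eq hx hy hn h1' h3' h2' h4' (b.trans c) c a)
  · rcases le_total x.rank u.rank with c | c
    · exact hn (corner_eq hu hv hne h1 h2 h3 h4 c (a.trans c) b)
    · exact hne (corner_eq hx hy hn h1' h3' h2' h4' c (b.trans c) a)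

/-! ### Functoriality of the free completion -/

/-- Isomorphisms of configurations. -/
structure Iso (C : Configuration A) (C' : Configuration B) extends A ≃ B where
  col_map : ∀ a, C'.col (toFun a) = C.col a
  adj_map : ∀ a b, C'.adj (toFun a) (toFun b) ↔ C.adj a b

/-- The inverse of an isomorphism. -/
def Iso.symm {C' : Configuration B} (f : C.Iso C') : C'.Iso C where
  toEquiv := f.toEquiv.symm
  col_map b := by rw [← f.col_map]; exact congrArg _ (f.toEquiv.apply_symm_apply b)
  adj_map a b := by
    rw [← f.adj_map]
    exact iff_of_eq (congrArg₂ _ (f.toEquiv.apply_symm_apply a) (f.toEquiv.apply_symm_apply b))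

variable {C' : Configuration B} (f : C.Iso C')

theorem lo_map {x u : FTerm A} (h : C.lo x u) : C'.lo (map f.toFun x) (map f.toFun u) := by
  rcases x with a | ⟨s, t⟩
  · rcases u with b | ⟨_, _⟩
    · exact (f.adj_map a b).2 h
    · exact h.elim
  · rcases h with rfl | rfl
    · exact lo_mkNode.2 (.inl rfl)
    · exact lo_mkNode.2 (.inr rfl)

/-- Mapping reorders each pair into its chosen order, so this needs validity, which says that the
pairs in `x` already are in that order. -/
theorem map_symm_map {x : FTerm A} (hx : C.Valid x) :
    map f.symm.toFun (map f.toFun x) = x := by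
  induction x with
  | base a => exact congrArg base (f.toEquiv.symm_apply_apply a)
  | node s t ihs iht =>
    rw [map, map_mkNode, ihs hx.1, iht hx.2.1]
    exact hx.2.2.2.2.1

theorem tcol_map {x : FTerm A} (hx : C.Valid x) : C'.tcol (map f.toFun x) = C.tcol x := by
  induction x with
  | base a => exact f.col_map a
  | node s t ihs iht =>
    rw [map, tcol_mkNode, ihs hx.1]
    · rfl
    · rw [ihs hx.1, iht hx.2.1, hx.2.2.2.1]

theorem lo_of_lo_map {x u : FTerm A} (hx : C.Valid x) {v : FTerm B} (hv : map f.symm.toFun v = u)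
    (h : C'.lo (map f.toFun x) v) : C.lo x u := by
  have := lo_map f.symm h
  rwa [map_symm_map f hx, hv] at this

theorem valid_map {x : FTerm A} (hx : C.Valid x) : C'.Valid (map f.toFun x) := by
  induction x with
  | base a => trivial
  | node s t ihs iht =>
    obtain ⟨hs, ht, hne, hc, -, hj⟩ := hx
    rw [map, valid_mkNode]
    refine ⟨ihs hs, iht ht, fun h => hne ?_, by rw [tcol_map f hs, tcol_map f ht, hc], ?_⟩
    · rw [← map_symm_map f hs, h, map_symm_map f ht]
    · rintro ⟨u, h⟩
      -- The witness `u` is an arbitrary term, not known to be an image; it is pulled back along the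
      -- inverse isomorphism.
      refine hj ⟨map f.symm.toFun u, ?_⟩
      rcases h with ⟨h1, h2⟩ | ⟨h1, h2⟩ | ⟨h1, h2⟩
      · exact .inl ⟨lo_of_lo_map f hs rfl h1, lo_of_lo_map f ht rfl h2⟩
      · refine .inr (.inl ⟨lo_of_lo_map f ht rfl h1, ?_⟩)
        have := lo_map f.symm h2
        rwa [map_symm_map f hs] at this
      · refine .inr (.inr ⟨lo_of_lo_map f hs rfl h1, ?_⟩)
        have := lo_map f.symm h2
        rwa [map_symm_map f ht] at this

variable (C) in
/-- The elements of the free completion. -/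
def Free : Type u := {x : FTerm A // C.Valid x}

namespace Free

variable (C) in
/-- The elements of the configuration as elements of the free completion. -/
def ofBase (a : A) : C.Free := ⟨base a, trivial⟩

/-- Adjacency in the free completion. -/
def Adj (x y : C.Free) : Prop := C.tadj x.1 y.1

/-- The colour of an element of the free completion. -/
def color (x : C.Free) : Bool := C.tcol x.1

theorem ofBase_injective : Function.Injective (ofBase C) := fun a b h => by
  have := congrArg Subtype.val h
  simpa [ofBase] using this

theorem Adj.symm {x y : C.Free} (h : x.Adj y) : y.Adj x := tadj_symm h

theorem Adj.color_ne {x y : C.Free} (h : x.Adj y) : x.color ≠ y.color := tadj_col_ne x.2 y.2 h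

theorem adj_ofBase {a b : A} : (ofBase C a).Adj (ofBase C b) ↔ C.adj a b :=
  ⟨fun h => h.elim id fun h => C.symm h, fun h => .inl h⟩

theorem exists_adj {x y : C.Free} (hne : x ≠ y) (hc : x.color = y.color) :
    ∃ u : C.Free, x.Adj u ∧ y.Adj u := by
  obtain ⟨u, hu, h⟩ := exists_common x.2 y.2 (fun h => hne (Subtype.ext h)) hc
  exact ⟨⟨u, hu⟩, h⟩

theorem adj_unique {x y u v : C.Free} (hne : x ≠ y) (h1 : x.Adj u) (h2 : y.Adj u) (h3 : x.Adj v)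
    (h4 : y.Adj v) : u = v :=
  Subtype.ext (common_unique x.2 y.2 u.2 v.2 (fun h => hne (Subtype.ext h)) h1 h2 h3 h4)

/-- Each element is in the base, or it has two distinct neighbours of smaller rank, and each of its
other neighbours has larger rank. -/
theorem eq_ofBase_or (x : C.Free) : (∃ a, x = ofBase C a) ∨
    ∃ s t : C.Free, s ≠ t ∧ x.Adj s ∧ x.Adj t ∧ s.1.rank < x.1.rank ∧ t.1.rank < x.1.rank ∧
      ∀ y : C.Free, x.Adj y → y.1.rank ≤ x.1.rank → y = s ∨ y = t := by
  obtain ⟨a | ⟨s, t⟩, hx⟩ := x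
  · exact .inl ⟨a, rfl⟩
  · refine .inr ⟨⟨s, hx.1⟩, ⟨t, hx.2.1⟩, fun h => hx.2.2.1 (congrArg Subtype.val h),
      .inl (.inl rfl), .inl (.inr rfl), ?_, ?_, ?_⟩
    · simp [rank]
    · simp [rank]
    · intro y hy hr
      rcases hy.resolve_right (not_lo_node hr) with h | h
      · exact .inl (Subtype.ext h)
      · exact .inr (Subtype.ext h)

end Free

/-! ### Confined sets and recovery of the base -/

/-- `x` is in a finite set each of whose elements has at least three neighbours in the set. -/
def InConfined {X : Type*} (r : X → X → Prop) (x : X) : Prop :=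
  ∃ S : Set X, S.Finite ∧ x ∈ S ∧ ∀ y ∈ S, ∃ a b c, a ∈ S ∧ b ∈ S ∧ c ∈ S ∧
    a ≠ b ∧ a ≠ c ∧ b ≠ c ∧ r y a ∧ r y b ∧ r y c

theorem InConfined.map {X Y : Type*} {r : X → X → Prop} {r' : Y → Y → Prop} {g : X → Y}
    (hg : Function.Injective g) (h : ∀ x y, r x y → r' (g x) (g y)) {x : X}
    (hx : InConfined r x) : InConfined r' (g x) := by
  obtain ⟨S, hS, hxS, hc⟩ := hx
  refine ⟨g '' S, hS.image g, ⟨x, hxS, rfl⟩, ?_⟩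
  rintro _ ⟨y, hy, rfl⟩
  obtain ⟨a, b, c, ha, hb, hc, hab, hac, hbc, h1, h2, h3⟩ := hc y hy
  exact ⟨g a, g b, g c, ⟨a, ha, rfl⟩, ⟨b, hb, rfl⟩, ⟨c, hc, rfl⟩, hg.ne hab, hg.ne hac, hg.ne hbc,
    h _ _ h1, h _ _ h2, h _ _ h3⟩

namespace Free

/-- A member of maximal rank outside the base would have three neighbours of no larger rank, but an
added element has only two. So the maximal rank is 0 and the whole set lies in the base. -/
theorem exists_ofBase_of_inConfined {x : C.Free} (hx : InConfined Adj x) :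
    ∃ a, x = ofBase C a := by
  obtain ⟨S, hS, hxS, hc⟩ := hx
  obtain ⟨m, hm, hmax⟩ := Set.exists_max_image S (fun y => y.1.rank) hS ⟨x, hxS⟩
  rcases eq_ofBase_or m with ⟨a, rfl⟩ | ⟨s, t, -, -, -, -, -, h⟩
  · have : x.1.rank = 0 := Nat.le_zero.1 (hmax x hxS)
    rcases eq_ofBase_or x with h | ⟨s, t, -, -, -, h, -⟩
    · exact h
    · omega
  · obtain ⟨a, b, c, ha, hb, hc, hab, hac, hbc, h1, h2, h3⟩ := hc m hm
    have := h a h1 (hmax a ha)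
    have := h b h2 (hmax b hb)
    have := h c h3 (hmax c hc)
    grind

/-- Colour preserving isomorphisms of free completions. -/
structure IsIso (C : Configuration A) (C' : Configuration B) (g : C.Free ≃ C'.Free) : Prop where
  color_map : ∀ x, (g x).color = x.color
  adj_map : ∀ x y, (g x).Adj (g y) ↔ x.Adj y

theorem IsIso.symm {g : C.Free ≃ C'.Free} (hg : IsIso C C' g) : IsIso C' C g.symm where
  color_map x := by rw [← hg.color_map, g.apply_symm_apply]
  adj_map x y := by rw [← hg.adj_map, g.apply_symm_apply, g.apply_symm_apply]

/-- The extension of an isomorphism to the free completions. -/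
noncomputable def ext (f : C.Iso C') : C.Free ≃ C'.Free where
  toFun x := ⟨map f.toFun x.1, valid_map f x.2⟩
  invFun y := ⟨map f.symm.toFun y.1, valid_map f.symm y.2⟩
  left_inv x := Subtype.ext (map_symm_map f x.2)
  right_inv y := Subtype.ext (map_symm_map f.symm y.2)

theorem ext_ofBase (f : C.Iso C') (a : A) : ext f (ofBase C a) = ofBase C' (f.toFun a) := rfl

theorem isIso_ext (f : C.Iso C') : IsIso C C' (ext f) where
  color_map x := tcol_map f x.2
  adj_map x y := by
    refine ⟨fun h => ?_, fun h => h.imp (lo_map f) (lo_map f)⟩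
    exact h.imp (lo_of_lo_map f x.2 (map_symm_map f y.2))
      (lo_of_lo_map f y.2 (map_symm_map f x.2))

/-- An isomorphism is determined by its values on the base. -/
theorem IsIso.ext_of_base {g h : C.Free ≃ C'.Free} (hg : IsIso C C' g) (hh : IsIso C C' h)
    (H : ∀ a, g (ofBase C a) = h (ofBase C a)) : g = h := by
  suffices ∀ n, ∀ x : C.Free, x.1.rank = n → g x = h x from Equiv.ext fun x => this _ x rfl
  intro n
  induction n using Nat.strong_induction_on with
  | _ n ih =>
    rintro x rfl
    rcases eq_ofBase_or x with ⟨a, rfl⟩ | ⟨s, t, hst, h1, h2, h3, h4, -⟩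
    · exact H a
    · refine adj_unique (g.injective.ne hst) ((hg.adj_map _ _).2 h1.symm)
        ((hg.adj_map _ _).2 h2.symm) ?_ ?_
      · rw [ih _ h3 s rfl]; exact (hh.adj_map _ _).2 h1.symm
      · rw [ih _ h4 t rfl]; exact (hh.adj_map _ _).2 h2.symm

/-- An isomorphism of the free completions of confined configurations comes from an isomorphism of
the configurations. -/
theorem IsIso.exists_eq_ext (hC : ∀ a, InConfined C.adj a) (hC' : ∀ b, InConfined C'.adj b)
    {g : C.Free ≃ C'.Free} (hg : IsIso C C' g) : ∃ f : C.Iso C', g = ext f := by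
  have key : ∀ {A B : Type u} {C : Configuration A} {C' : Configuration B}
      {g : C.Free ≃ C'.Free}, IsIso C C' g → (∀ a, InConfined C.adj a) →
      ∀ a, ∃ b, g (ofBase C a) = ofBase C' b := by
    intro A B C C' g hg hC a
    exact exists_ofBase_of_inConfined (((hC a).map (r' := Adj) ofBase_injective
      fun _ _ => adj_ofBase.2).map g.injective fun x y => (hg.adj_map x y).2)
  choose p hp using key hg hC
  choose q hq using key hg.symm hC'
  let f : C.Iso C' :=
    { toFun := p
      invFun := q
      left_inv := fun a => ofBase_injective (by rw [← hq, ← hp, g.symm_apply_apply])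
      right_inv := fun b => ofBase_injective (by rw [← hp, ← hq, g.apply_symm_apply])
      col_map := fun a => by
        have := hg.color_map (ofBase C a)
        rwa [hp] at this
      adj_map := fun a b => by
        have := hg.adj_map (ofBase C a) (ofBase C b)
        rwa [hp, hp, adj_ofBase, adj_ofBase] at this }
  exact ⟨f, hg.ext_of_base (isIso_ext f) fun a => hp a⟩

theorem ofBase_color (a : A) : (ofBase C a).color = C.col a := rfl

/-- The common neighbour which is added for two elements without an earlier common neighbour. -/
noncomputable def join (x y : C.Free) (hne : x ≠ y) (hc : x.color = y.color)
    (h : ¬ C.Joined x.1 y.1) : C.Free :=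
  ⟨mkNode x.1 y.1, valid_mkNode.2 ⟨x.2, y.2, fun e => hne (Subtype.ext e), hc, h⟩⟩

theorem adj_join_left (x y : C.Free) (hne : x ≠ y) (hc : x.color = y.color)
    (h : ¬ C.Joined x.1 y.1) : x.Adj (join x y hne hc h) := .inr (lo_mkNode.2 (.inl rfl))

theorem adj_join_right (x y : C.Free) (hne : x ≠ y) (hc : x.color = y.color)
    (h : ¬ C.Joined x.1 y.1) : y.Adj (join x y hne hc h) := .inr (lo_mkNode.2 (.inr rfl))

end Free

end Configuration

/-! ### The configuration of a graph -/

/-- The elements of the configuration of a graph: each vertex `v` gives a path `vert v 0`, ...,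
`vert v 7`, and each pair of distinct vertices gives two incident pairs of a point and a line. -/
inductive Elt (V : Type u) : Type u
  | vert (v : V) (i : Fin 8) : Elt V
  | pt (v w : V) (h : v ≠ w) (k : Bool) : Elt V
  | ln (v w : V) (h : v ≠ w) (k : Bool) : Elt V

namespace Elt

variable {V W : Type u}

/-- The points are the elements of colour `true`. -/
def col : Elt V → Bool
  | vert _ i => i.val % 2 == 0
  | pt _ _ _ _ => true
  | ln _ _ _ _ => false

/-- The adjacencies of the configuration of `Γ`, each in one direction. -/
def Inc (Γ : SimpleGraph V) : Elt V → Elt V → Prop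
  | vert v i, vert w j => v = w ∧ i.val + 1 = j.val
  | pt v w _ k, vert x i => (x = v ∧ i.val = 5 + 2 * k.toNat) ∨ (x = w ∧ i.val = 1 + 2 * k.toNat)
  | ln v w _ k, vert x i => (x = v ∧ ((i.val = 0 ∧ (k = true ↔ Γ.Adj v w)) ∨
      (i.val = 2 ∧ ¬ (k = true ↔ Γ.Adj v w)))) ∨ (x = w ∧ i.val = 4 + 2 * k.toNat)
  | pt v w _ k, ln v' w' _ k' => v = v' ∧ w = w' ∧ k = k'
  | _, _ => False

theorem Inc.col_ne {Γ : SimpleGraph V} {a b : Elt V} (h : Inc Γ a b) : a.col ≠ b.col := by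
  cases a <;> cases b <;> simp only [Inc, col] at h ⊢
  · have : ∀ i j : Fin 8, i.val + 1 = j.val → (i.val % 2 == 0) ≠ (j.val % 2 == 0) := by decide
    exact this _ _ h.2
  · rename_i v w _ k x i
    have : ∀ (i : Fin 8) (k : Bool), (i.val = 5 + 2 * k.toNat ∨ i.val = 1 + 2 * k.toNat) →
      true ≠ (i.val % 2 == 0) := by decide
    exact this i k (by tauto)
  · simp
  · rename_i v w _ k x i
    have : ∀ (i : Fin 8) (k : Bool), (i.val = 0 ∨ i.val = 2 ∨ i.val = 4 + 2 * k.toNat) →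
      false ≠ (i.val % 2 == 0) := by decide
    exact this i k (by tauto)

/-- The positions are chosen to exclude quadrangles. Points use positions 5, 7 at the first vertex
and 1, 3 at the second; lines use 0, 2 and 4, 6; so two points, or two lines, never share two path
elements. An incident point and line with the same `k` are never tied to consecutive positions of
one path: `1 + 2k` and `4 + 2k` differ by 3, and 5, 7 are far from 0, 2. -/
theorem rel_unique {Γ : SimpleGraph V} {a b u v : Elt V} (hne : a ≠ b)
    (h1 : Inc Γ a u ∨ Inc Γ u a) (h2 : Inc Γ b u ∨ Inc Γ u b)
    (h3 : Inc Γ a v ∨ Inc Γ v a) (h4 : Inc Γ b v ∨ Inc Γ v b) : u = v := by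
  by_contra hn
  rcases a with ⟨a, i⟩ | ⟨a, a', ha, i⟩ | ⟨a, a', ha, i⟩ <;>
  rcases b with ⟨b, j⟩ | ⟨b, b', hb, j⟩ | ⟨b, b', hb, j⟩ <;>
  rcases u with ⟨u, k⟩ | ⟨u, u', hu, k⟩ | ⟨u, u', hu, k⟩ <;>
  simp only [Inc, or_false, false_or] at h1 h2 <;>
  rcases v with ⟨v, l⟩ | ⟨v, v', hv, l⟩ | ⟨v, v', hv, l⟩ <;>
  simp only [Inc, or_false, false_or] at h3 h4 <;>
  simp only [vert.injEq, pt.injEq, ln.injEq, Fin.ext_iff, reduceCtorEq, not_false_eq_true]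
    at hne hn <;>
  first | omega | grind | grind [Bool.toNat]

/-- The elements which only involve vertices in `S`. -/
def Supp (S : Set V) : Elt V → Prop
  | vert v _ => v ∈ S
  | pt v w _ _ => v ∈ S ∧ w ∈ S
  | ln v w _ _ => v ∈ S ∧ w ∈ S

/-- An injective coding of the elements. -/
def code : Elt V → V × V × Fin 8 × Fin 3
  | vert v i => (v, v, i, 0)
  | pt v w _ k => (v, w, if k then 1 else 0, 1)
  | ln v w _ k => (v, w, if k then 1 else 0, 2)

theorem code_injective : Function.Injective (code (V := V)) := by
  rintro (⟨a, i⟩ | ⟨a, a', ha, i⟩ | ⟨a, a', ha, i⟩) (⟨b, j⟩ | ⟨b, b', hb, j⟩ | ⟨b, b', hb, j⟩) h <;>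
  simp_all [code]
  all_goals cases i <;> cases j <;> simp_all

theorem finite_supp {S : Set V} (hS : S.Finite) : {x : Elt V | Supp S x}.Finite := by
  refine ((hS.prod (hS.prod (Set.finite_univ (α := Fin 8 × Fin 3)))).preimage
    code_injective.injOn).subset ?_
  rintro (⟨a, i⟩ | ⟨a, a', ha, i⟩ | ⟨a, a', ha, i⟩) h
  · exact ⟨h, h, trivial⟩
  · exact ⟨h.1, h.2, trivial⟩
  · exact ⟨h.1, h.2, trivial⟩

instance [Infinite V] : Infinite (Elt V) :=
  Infinite.of_injective (fun v => vert v 0) fun v w h => by simpa using h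

open Cardinal in
theorem cardinal_le [Infinite V] : #(Elt V) ≤ #V := by
  refine (Cardinal.mk_le_of_injective code_injective).trans ?_
  have hV := Cardinal.aleph0_le_mk V
  have h : (8 * 3 : Cardinal.{u}) ≤ #V :=
    le_trans (by exact_mod_cast (Cardinal.natCast_lt_aleph0 (n := 24)).le) hV
  simp only [mk_prod, lift_id, mk_fin, lift_mul, lift_ofNat, lift_uzero, Nat.cast_ofNat]
  rw [Cardinal.mul_eq_left hV h (by norm_num), Cardinal.mul_eq_self hV]

/-- The map induced by a bijection between the vertices. -/
def map (σ : V ≃ W) : Elt V → Elt W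
  | vert v i => vert (σ v) i
  | pt v w h k => pt (σ v) (σ w) (σ.injective.ne h) k
  | ln v w h k => ln (σ v) (σ w) (σ.injective.ne h) k

theorem map_symm_map (σ : V ≃ W) (x : Elt V) : map σ.symm (map σ x) = x := by
  cases x <;> simp [map]

theorem col_map (σ : V ≃ W) (x : Elt V) : (map σ x).col = x.col := by
  cases x <;> rfl

theorem rel_map {Γ : SimpleGraph V} {Γ' : SimpleGraph W} (σ : Γ ≃g Γ') (x y : Elt V) :
    Inc Γ' (map σ.toEquiv x) (map σ.toEquiv y) ↔ Inc Γ x y := by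
  have h : ∀ v w, Γ'.Adj (σ v) (σ w) ↔ Γ.Adj v w := fun v w => σ.map_rel_iff
  cases x <;> cases y <;> simp [map, Inc, h]

end Elt

section GraphConfiguration

open Elt Configuration

variable {V W : Type u}

/-- The configuration of a graph. -/
def graphConfig (Γ : SimpleGraph V) : Configuration (Elt V) where
  col := col
  adj x y := Inc Γ x y ∨ Inc Γ y x
  symm := Or.symm
  col_ne h := h.elim Inc.col_ne fun h => h.col_ne.symm
  unique := rel_unique

namespace graphConfig

variable {Γ : SimpleGraph V} {Γ' : SimpleGraph W}

/-- The isomorphism of configurations induced by an isomorphism of graphs. -/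
def isoOf (σ : Γ ≃g Γ') : (graphConfig Γ).Iso (graphConfig Γ') where
  toFun := Elt.map σ.toEquiv
  invFun := Elt.map σ.toEquiv.symm
  left_inv := map_symm_map _
  right_inv := map_symm_map σ.toEquiv.symm
  col_map := Elt.col_map _
  adj_map x y := or_congr (rel_map σ x y) (rel_map σ y x)

theorem adj_vert_vert {v w : V} {i j : Fin 8} :
    (graphConfig Γ).adj (vert v i) (vert w j) ↔
      v = w ∧ (i.val + 1 = j.val ∨ j.val + 1 = i.val) := by
  simp only [graphConfig, Inc]
  grind

theorem adj_pt_left (v w : V) (h : v ≠ w) (k : Bool) :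
    (graphConfig Γ).adj (pt v w h k) (vert v ⟨5 + 2 * k.toNat, by cases k <;> decide⟩) :=
  .inl (.inl ⟨rfl, rfl⟩)

theorem adj_pt_right (v w : V) (h : v ≠ w) (k : Bool) :
    (graphConfig Γ).adj (pt v w h k) (vert w ⟨1 + 2 * k.toNat, by cases k <;> decide⟩) :=
  .inl (.inr ⟨rfl, rfl⟩)

theorem adj_ln_right (v w : V) (h : v ≠ w) (k : Bool) :
    (graphConfig Γ).adj (ln v w h k) (vert w ⟨4 + 2 * k.toNat, by cases k <;> decide⟩) :=
  .inl (.inr ⟨rfl, rfl⟩)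

theorem adj_pt_ln (v w : V) (h : v ≠ w) (k : Bool) :
    (graphConfig Γ).adj (pt v w h k) (ln v w h k) :=
  .inl ⟨rfl, rfl, rfl⟩

theorem adj_ln_left_iff (v w : V) (h : v ≠ w) (k : Bool) :
    (graphConfig Γ).adj (ln v w h k) (vert v 0) ↔ (k = true ↔ Γ.Adj v w) := by
  simp [graphConfig, Inc, h]

theorem exists_adj_ln (v w : V) (h : v ≠ w) (k : Bool) :
    ∃ i : Fin 8, (i = 0 ∨ i = 2) ∧ (graphConfig Γ).adj (ln v w h k) (vert v i) := by
  by_cases hk : k = true ↔ Γ.Adj v w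
  · exact ⟨0, .inl rfl, .inl (.inl ⟨rfl, .inl ⟨rfl, hk⟩⟩)⟩
  · exact ⟨2, .inr rfl, .inl (.inl ⟨rfl, .inr ⟨rfl, hk⟩⟩)⟩

/-- The vertex elements have a neighbour for each other vertex. -/
theorem exists_neighbors (Γ : SimpleGraph V) (v : V) (i : Fin 8) :
    ∃ f : {w // w ≠ v} → Elt V, Function.Injective f ∧
      ∀ w, (graphConfig Γ).adj (vert v i) (f w) ∧ ∀ S : Set V, v ∈ S → w.1 ∈ S → Supp S (f w) := by
  classical
  have h : i = 0 ∨ i = 2 ∨ (∃ k : Bool, i.val = 4 + 2 * k.toNat) ∨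
      (∃ k : Bool, i.val = 5 + 2 * k.toNat) ∨ (∃ k : Bool, i.val = 1 + 2 * k.toNat) := by
    revert i; decide
  rcases h with rfl | rfl | ⟨k, hk⟩ | ⟨k, hk⟩ | ⟨k, hk⟩
  -- For each `w` exactly one of the two lines is tied to position 0 and the other to position 2.
  -- This is why the pairs are doubled: both positions get a neighbour whether or not `v` and `w`
  -- are adjacent.
  · refine ⟨fun w => ln v w.1 w.2.symm (decide (Γ.Adj v w.1)), fun w w' h => ?_, fun w =>
      ⟨.inr (.inl ⟨rfl, .inl ⟨rfl, by simp⟩⟩), fun S h1 h2 => ⟨h1, h2⟩⟩⟩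
    simp only [ln.injEq] at h
    exact Subtype.ext h.2.1
  · refine ⟨fun w => ln v w.1 w.2.symm (!decide (Γ.Adj v w.1)), fun w w' h => ?_, fun w =>
      ⟨.inr (.inl ⟨rfl, .inr ⟨rfl, by simp⟩⟩), fun S h1 h2 => ⟨h1, h2⟩⟩⟩
    simp only [ln.injEq] at h
    exact Subtype.ext h.2.1
  · refine ⟨fun w => ln w.1 v w.2 k, fun w w' h => ?_, fun w =>
      ⟨.inr (.inr ⟨rfl, hk⟩), fun S h1 h2 => ⟨h2, h1⟩⟩⟩
    simp only [ln.injEq] at h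
    exact Subtype.ext h.1
  · refine ⟨fun w => pt v w.1 w.2.symm k, fun w w' h => ?_, fun w =>
      ⟨.inr (.inl ⟨rfl, hk⟩), fun S h1 h2 => ⟨h1, h2⟩⟩⟩
    simp only [pt.injEq] at h
    exact Subtype.ext h.2.1
  · refine ⟨fun w => pt w.1 v w.2 k, fun w w' h => ?_, fun w =>
      ⟨.inr (.inr ⟨rfl, hk⟩), fun S h1 h2 => ⟨h2, h1⟩⟩⟩
    simp only [pt.injEq] at h
    exact Subtype.ext h.1

theorem inConfined [Infinite V] (Γ : SimpleGraph V) (x : Elt V) :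
    InConfined (graphConfig Γ).adj x := by
  classical
  -- Four vertices suffice: a path element then has one neighbour for each of the three other
  -- vertices, and the remaining elements have three neighbours supported on their own two vertices.
  obtain ⟨T, hT, hx⟩ : ∃ T : Finset V, T.card = 4 ∧ Supp (T : Set V) x := by
    have key : ∀ v w : V, ∃ T : Finset V, T.card = 4 ∧ v ∈ T ∧ w ∈ T := by
      intro v w
      obtain ⟨T, h1, h2⟩ := Infinite.exists_superset_card_eq ({v, w} : Finset V) 4
        (Finset.card_le_two.trans (by norm_num))
      exact ⟨T, h2, h1 (by simp), h1 (by simp)⟩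
    rcases x with ⟨v, i⟩ | ⟨v, w, h, k⟩ | ⟨v, w, h, k⟩
    · obtain ⟨T, h1, h2, -⟩ := key v v
      exact ⟨T, h1, h2⟩
    · exact key v w
    · exact key v w
  refine ⟨{x | Supp (T : Set V) x}, finite_supp T.finite_toSet, hx, ?_⟩
  rintro (⟨v, i⟩ | ⟨v, w, h, k⟩ | ⟨v, w, h, k⟩) hy
  · have hv : v ∈ T := hy
    obtain ⟨a, b, c, hab, hac, hbc, he⟩ := Finset.card_eq_three.1
      (show (T.erase v).card = 3 by rw [Finset.card_erase_of_mem hv, hT])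
    have ha : a ∈ T.erase v := by simp [he]
    have hb : b ∈ T.erase v := by simp [he]
    have hc : c ∈ T.erase v := by simp [he]
    rw [Finset.mem_erase] at ha hb hc
    obtain ⟨f, hf, hadj⟩ := exists_neighbors Γ v i
    refine ⟨f ⟨a, ha.1⟩, f ⟨b, hb.1⟩, f ⟨c, hc.1⟩, (hadj _).2 _ hv ha.2, (hadj _).2 _ hv hb.2,
      (hadj _).2 _ hv hc.2, hf.ne ?_, hf.ne ?_, hf.ne ?_, (hadj _).1, (hadj _).1, (hadj _).1⟩
    all_goals simpa
  · exact ⟨_, _, ln v w h k, hy.1, hy.2, hy, by simp [h], by simp, by simp,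
      adj_pt_left v w h k, adj_pt_right v w h k, adj_pt_ln v w h k⟩
  · obtain ⟨i, -, hi⟩ := exists_adj_ln (Γ := Γ) v w h k
    exact ⟨vert v i, _, pt v w h k, hy.1, hy.2, hy, by simp [h], by simp, by simp,
      hi, adj_ln_right v w h k, (graphConfig Γ).symm (adj_pt_ln v w h k)⟩

/-- The vertex elements are the elements with infinitely many neighbours. -/
theorem infinite_neighbors_iff [Infinite V] (x : Elt V) :
    {y | (graphConfig Γ).adj x y}.Infinite ↔ ∃ v i, x = vert v i := by
  constructor
  · intro h
    by_contra hx
    refine h ?_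
    rcases x with ⟨v, i⟩ | ⟨v, w, hvw, k⟩ | ⟨v, w, hvw, k⟩
    · exact (hx ⟨v, i, rfl⟩).elim
    · refine (((Set.finite_range (vert v)).union (Set.finite_range (vert w))).union
        (Set.finite_singleton (ln v w hvw k))).subset ?_
      rintro (⟨a, i⟩ | ⟨a, b, hab, i⟩ | ⟨a, b, hab, i⟩) (h | h) <;> simp only [Inc] at h
      · rcases h with ⟨rfl, -⟩ | ⟨rfl, -⟩ <;> simp
      · obtain ⟨rfl, rfl, rfl⟩ := h
        simp
    · refine (((Set.finite_range (vert v)).union (Set.finite_range (vert w))).union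
        (Set.finite_singleton (pt v w hvw k))).subset ?_
      rintro (⟨a, i⟩ | ⟨a, b, hab, i⟩ | ⟨a, b, hab, i⟩) (h | h) <;> simp only [Inc] at h
      · rcases h with ⟨rfl, -⟩ | ⟨rfl, -⟩ <;> simp
      · obtain ⟨rfl, rfl, rfl⟩ := h
        simp
  · rintro ⟨v, i, rfl⟩
    obtain ⟨f, hf, hadj⟩ := exists_neighbors Γ v i
    have : Infinite {w // w ≠ v} := (Set.finite_singleton v).infinite_compl.to_subtype
    exact Set.infinite_of_injective_forall_mem hf fun w => (hadj w).1

/-! ### Rigidity: isomorphisms of configurations come from graphs -/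

section Rigid

variable [Infinite V] [Infinite W] (f : (graphConfig Γ).Iso (graphConfig Γ'))

theorem iso_vert (v : V) (i : Fin 8) : ∃ w j, f.toFun (vert v i) = vert w j := by
  rw [← infinite_neighbors_iff (Γ := Γ')]
  have h := (infinite_neighbors_iff (Γ := Γ) (vert v i)).2 ⟨v, i, rfl⟩
  refine (h.image f.toEquiv.injective.injOn).mono ?_
  rintro _ ⟨y, hy, rfl⟩
  exact (f.adj_map _ _).2 hy

theorem vert_of_iso_vert {x : Elt V} {w : W} {j : Fin 8} (h : f.toFun x = vert w j) :
    ∃ v i, x = vert v i := by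
  obtain ⟨v, i, hv⟩ := iso_vert f.symm w j
  refine ⟨v, i, ?_⟩
  rw [← hv, ← h]
  exact (f.toEquiv.symm_apply_apply x).symm

/-- By colour the image has even position `j`. If `j ≠ 0`, then both `j - 1` and `j + 1` are
positions (the last one is 7, which is odd), and both elements would be the image of `vert v 1`, the
only path neighbour of `vert v 0`. -/
theorem iso_vert_zero (v : V) : ∃ w, f.toFun (vert v 0) = vert w 0 := by
  obtain ⟨w, j, hw⟩ := iso_vert f v 0
  have hcol := f.col_map (vert v 0)
  rw [hw] at hcol
  have hj : j.val % 2 = 0 := by simpa [graphConfig, Elt.col] using hcol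
  by_cases h0 : j.val = 0
  · exact ⟨w, by rw [hw]; congr 1; exact Fin.ext h0⟩
  have key : ∀ l : Fin 8, (l.val + 1 = j.val ∨ j.val + 1 = l.val) →
      f.toFun (vert v 1) = vert w l := by
    intro l hl
    have hx : f.toFun (f.symm.toFun (vert w l)) = vert w l := f.toEquiv.apply_symm_apply _
    obtain ⟨v', i, hv'⟩ := vert_of_iso_vert f hx
    rw [hv'] at hx
    have : (graphConfig Γ').adj (f.toFun (vert v 0)) (f.toFun (vert v' i)) := by
      rw [hx, hw]
      exact adj_vert_vert.2 ⟨rfl, hl.symm⟩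
    rw [f.adj_map, adj_vert_vert] at this
    obtain ⟨rfl, h⟩ := this
    have : i = 1 := Fin.ext (by simp at h ⊢; omega)
    rwa [this] at hx
  have h1 := key ⟨j.val - 1, by omega⟩ (.inl (by simp; omega))
  have h2 := key ⟨j.val + 1, by omega⟩ (.inr rfl)
  rw [h1] at h2
  simp at h2

theorem iso_vert_eq {v : V} {w : W} (h : f.toFun (vert v 0) = vert w 0) (i : Fin 8) :
    f.toFun (vert v i) = vert w i := by
  obtain ⟨n, hn⟩ := i
  induction n using Nat.strong_induction_on with
  | _ n ih =>
    rcases n with _ | n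
    · exact h
    · obtain ⟨w', j, hw'⟩ := iso_vert f v ⟨n + 1, hn⟩
      have hadj : (graphConfig Γ').adj (f.toFun (vert v ⟨n, by omega⟩))
          (f.toFun (vert v ⟨n + 1, hn⟩)) :=
        (f.adj_map _ _).2 (adj_vert_vert.2 ⟨rfl, .inl rfl⟩)
      rw [hw', ih n (by omega), adj_vert_vert] at hadj
      obtain ⟨rfl, hj | hj⟩ := hadj
      · rw [hw']
        congr 1
        exact Fin.ext hj.symm
      -- A step backwards would hit an element that is already the image of an earlier position.
      · have := ih j.val (by simp at hj; omega) j.2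
        rw [Fin.eta, ← hw'] at this
        have := f.toEquiv.injective this
        simp only [vert.injEq, true_and, Fin.ext_iff] at this
        simp at hj
        omega

/-- A point of this kind is the unique common neighbour of two path elements whose images are known.
-/
theorem iso_pt_eq {v v' : V} {w w' : W} (h : f.toFun (vert v 0) = vert w 0)
    (h' : f.toFun (vert v' 0) = vert w' 0) (hv : v ≠ v') (hw : w ≠ w') (k : Bool) :
    f.toFun (pt v v' hv k) = pt w w' hw k := by
  refine (graphConfig Γ').unique ?_ ?_ ?_ ((graphConfig Γ').symm (adj_pt_left w w' hw k))
    ((graphConfig Γ').symm (adj_pt_right w w' hw k))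
  · simp [hw]
  · rw [← iso_vert_eq f h, f.adj_map]
    exact (graphConfig Γ).symm (adj_pt_left v v' hv k)
  · rw [← iso_vert_eq f h', f.adj_map]
    exact (graphConfig Γ).symm (adj_pt_right v v' hv k)

/-- The line is the only neighbour of its point that is not a path element. -/
theorem iso_ln_eq {v v' : V} {w w' : W} (h : f.toFun (vert v 0) = vert w 0)
    (h' : f.toFun (vert v' 0) = vert w' 0) (hv : v ≠ v') (hw : w ≠ w') (k : Bool) :
    f.toFun (ln v v' hv k) = ln w w' hw k := by
  have hadj := (f.adj_map _ _).2 (adj_pt_ln (Γ := Γ) v v' hv k)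
  rw [iso_pt_eq f h h' hv hw] at hadj
  rcases hx : f.toFun (ln v v' hv k) with ⟨a, i⟩ | ⟨a, b, hab, i⟩ | ⟨a, b, hab, i⟩
  · obtain ⟨_, _, h⟩ := vert_of_iso_vert f hx
    simp at h
  · rw [hx] at hadj
    simp [graphConfig, Inc] at hadj
  · rw [hx] at hadj
    rcases hadj with ⟨rfl, rfl, rfl⟩ | h
    · rfl
    · exact h.elim

/-- The isomorphisms between configurations of graphs come from the isomorphisms between the
graphs. -/
theorem exists_eq_isoOf : ∃ σ : Γ ≃g Γ', f.toFun = (isoOf σ).toFun := by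
  choose s hs using iso_vert_zero f
  choose t ht using iso_vert_zero f.symm
  have hst : ∀ w, s (t w) = w := fun w => by
    have : f.toFun (f.symm.toFun (vert w 0)) = vert w 0 := f.toEquiv.apply_symm_apply _
    rw [ht, hs] at this
    simpa using this
  have hts : ∀ v, t (s v) = v := fun v => by
    have : f.symm.toFun (f.toFun (vert v 0)) = vert v 0 := f.toEquiv.symm_apply_apply _
    rw [hs, ht] at this
    simpa using this
  let σ : V ≃ W := ⟨s, t, hts, hst⟩
  refine ⟨⟨σ, ?_⟩, ?_⟩
  · intro v w
    by_cases hvw : v = w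
    · subst hvw; simp
    · have hne : s v ≠ s w := σ.injective.ne hvw
      -- For `k = true` this incidence holds exactly when `v` and `w` are adjacent, so preserving it
      -- preserves edges.
      have := f.adj_map (ln v w hvw true) (vert v 0)
      rw [iso_ln_eq f (hs v) (hs w) hvw hne, hs v, adj_ln_left_iff, adj_ln_left_iff] at this
      simp only [true_iff] at this
      exact this
  · funext x
    rcases x with ⟨v, i⟩ | ⟨v, w, h, k⟩ | ⟨v, w, h, k⟩
    · exact iso_vert_eq f (hs v) i
    · exact iso_pt_eq f (hs v) (hs w) h _ k
    · exact iso_ln_eq f (hs v) (hs w) h _ k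

end Rigid

end graphConfig

end GraphConfiguration

/-! ### Free completions as projective, non-Desarguesian planes -/

namespace FTerm

variable {A : Type u}

theorem mkNode_inj {s t s' t' : FTerm A} (h : mkNode s t = mkNode s' t') :
    (s = s' ∧ t = t') ∨ (s = t' ∧ t = s') := by
  rcases mkNode_eq_or s t with h1 | h1 <;> rcases mkNode_eq_or s' t' with h2 | h2 <;>
    rw [h1, h2, node.injEq] at h <;> tauto

end FTerm

namespace Configuration

open FTerm

variable {A B : Type u} {C : Configuration A} {C' : Configuration B}

theorem Joined.of_base {p q : A} (h : C.Joined (base p) (base q)) :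
    ∃ u, C.adj p u ∧ C.adj q u := by
  obtain ⟨u | ⟨s, t⟩, h⟩ := h
  · refine ⟨u, ?_⟩
    have e : ∀ {a b : A}, C.lo (base a) (base b) ↔ C.adj a b := Iff.rfl
    simp only [e] at h
    have := C.symm (a := u) (b := p)
    have := C.symm (a := u) (b := q)
    tauto
  · simp [lo] at h

theorem lo_base_mkNode {a : A} {s t : FTerm A} : ¬ C.lo (base a) (mkNode s t) :=
  fun h => h

theorem lo_mkNode_mkNode_base {a b : A} {s t : FTerm A} :
    ¬ C.lo (mkNode (base a) (base b)) (mkNode s t) := fun h => by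
  rcases lo_mkNode.1 h with h | h <;> exact mkNode_ne_base _ _ _ h

/-- Below such a node lie only two base elements, and no node lies below a base element; so the
nodes could be joined only through a shared base element. -/
theorem not_joined_mkNode {p q p' q' : A} (h : p ≠ p' ∧ p ≠ q' ∧ q ≠ p' ∧ q ≠ q') :
    ¬ C.Joined (mkNode (base p) (base q)) (mkNode (base p') (base q')) := by
  have e : ∀ {a b : A} {u s t : FTerm A}, C.lo (mkNode (base a) (base b)) u →
      ¬ C.lo u (mkNode s t) := by
    intro a b u s t h1
    rcases lo_mkNode.1 h1 with rfl | rfl <;> exact lo_base_mkNode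
  rintro ⟨u, ⟨h1, h2⟩ | ⟨h1, h2⟩ | ⟨h1, h2⟩⟩
  · rw [lo_mkNode] at h1 h2
    rcases h1 with rfl | rfl <;> simp at h2 <;> tauto
  · exact e h1 h2
  · exact e h1 h2

/-- The incidence structure on `D` which is the free completion of `C`. -/
def planeOn {D : Type*} (e : D ≃ C.Free) : IncStr D where
  pt x := (e x).color = true
  ln x := (e x).color = false
  inc x y := (e x).color = true ∧ (e y).color = false ∧ (e x).Adj (e y)

namespace Free

theorem IsIso.trans {A' : Type u} {C'' : Configuration A'} {g : C.Free ≃ C'.Free}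
    {h : C'.Free ≃ C''.Free} (hg : IsIso C C' g) (hh : IsIso C' C'' h) :
    IsIso C C'' (g.trans h) where
  color_map x := (hh.color_map _).trans (hg.color_map x)
  adj_map x y := (hh.adj_map _ _).trans (hg.adj_map x y)

/-- The common neighbour of `p` and `q` is a freely added one, whose only neighbours in the base are
`p` and `q`. -/
theorem not_adj_three {p q r : A} (hpq : p ≠ q) (hrp : r ≠ p) (hrq : r ≠ q)
    (hc : C.col p = C.col q) (h : ¬ ∃ u, C.adj p u ∧ C.adj q u) (l : C.Free)
    (h1 : (ofBase C p).Adj l) (h2 : (ofBase C q).Adj l) : ¬ (ofBase C r).Adj l := by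
  have hj : ¬ C.Joined (ofBase C p).1 (ofBase C q).1 := fun h' => h h'.of_base
  have hne : ofBase C p ≠ ofBase C q := ofBase_injective.ne hpq
  have := adj_unique hne h1 h2 (adj_join_left _ _ hne hc hj) (adj_join_right _ _ hne hc hj)
  subst this
  rintro (h3 | h3)
  · exact lo_base_mkNode h3
  · rcases lo_mkNode.1 h3 with h3 | h3
    · exact hrp (by simpa [ofBase] using h3)
    · exact hrq (by simpa [ofBase] using h3)

theorem exists_two_adj (hC : ∀ a, InConfined C.adj a) (x : C.Free) :
    ∃ s t : C.Free, s ≠ t ∧ x.Adj s ∧ x.Adj t := by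
  rcases eq_ofBase_or x with ⟨a, rfl⟩ | ⟨s, t, hst, h1, h2, -⟩
  · obtain ⟨S, -, ha, h⟩ := hC a
    obtain ⟨s, t, -, -, -, -, hst, -, -, h1, h2, -⟩ := h a ha
    exact ⟨_, _, ofBase_injective.ne hst, adj_ofBase.2 h1, adj_ofBase.2 h2⟩
  · exact ⟨s, t, hst, h1, h2⟩

end Free

open Free

/-- The free completion of a confined configuration with three points two of which are not on a
common line is a projective plane. -/
theorem isProjectivePlane_planeOn {D : Type*} (e : D ≃ C.Free) (hC : ∀ a, InConfined C.adj a)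
    {p q r : A} (hpq : p ≠ q) (hrp : r ≠ p) (hrq : r ≠ q) (hp : C.col p = true)
    (hq : C.col q = true) (hr : C.col r = true) (h : ¬ ∃ u, C.adj p u ∧ C.adj q u) :
    (planeOn e).IsProjectivePlane where
  pt_or_ln x := by
    change (e x).color = true ∨ (e x).color = false
    cases (e x).color <;> simp
  not_both x h := by
    have h1 : (e x).color = true := h.1
    have h2 : (e x).color = false := h.2
    simp [h1] at h2
  inc_sorts x y h := ⟨h.1, h.2.1⟩
  join x y hx hy hne := by
    have hx : (e x).color = true := hx
    have hy : (e y).color = true := hy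
    obtain ⟨u, h1, h2⟩ := exists_adj (e.injective.ne hne) (hx.trans hy.symm)
    have hu : u.color = false := by
      have := h1.color_ne
      rw [hx] at this
      simpa using this.symm
    refine ⟨e.symm u, ⟨?_, ⟨hx, ?_, ?_⟩, hy, ?_, ?_⟩, ?_⟩
    any_goals simpa [planeOn]
    rintro v ⟨-, h3, h4⟩
    rw [Equiv.eq_symm_apply]
    exact adj_unique (e.injective.ne hne) h3.2.2 h4.2.2 h1 h2
  meet_le_one l m _ _ hlm x y h1 h2 h3 h4 :=
    e.injective (adj_unique (e.injective.ne hlm) h1.2.2.symm h2.2.2.symm h3.2.2.symm h4.2.2.symm)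
  two_points l hl := by
    have hl : (e l).color = false := hl
    obtain ⟨s, t, hst, h1, h2⟩ := exists_two_adj hC (e l)
    have h1' := h1.color_ne
    have h2' := h2.color_ne
    rw [hl] at h1' h2'
    refine ⟨e.symm s, e.symm t, e.symm.injective.ne hst, ⟨?_, hl, ?_⟩, ⟨?_, hl, ?_⟩⟩
    · simpa using h1'.symm
    · simpa using h1.symm
    · simpa using h2'.symm
    · simpa using h2.symm
  three_points := by
    refine ⟨e.symm (ofBase C p), e.symm (ofBase C q), e.symm (ofBase C r), ?_, ?_, ?_, ?_⟩
    any_goals simpa [planeOn]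
    rintro ⟨l, -, ⟨-, -, h1⟩, ⟨-, -, h2⟩, -, -, h3⟩
    rw [Equiv.apply_symm_apply] at h1 h2 h3
    exact not_adj_three hpq hrp hrq (hp.trans hq.symm) h (e l) h1 h2 h3
  meet x y hx hy hne := by
    have hx : (e x).color = false := hx
    have hy : (e y).color = false := hy
    obtain ⟨u, h1, h2⟩ := exists_adj (e.injective.ne hne) (hx.trans hy.symm)
    have hu : u.color = true := by
      have := h1.color_ne
      rw [hx] at this
      simpa using this.symm
    refine ⟨e.symm u, ⟨?_, ⟨?_, hx, ?_⟩, ?_, hy, ?_⟩, ?_⟩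
    any_goals simpa [planeOn]
    · simpa using h1.symm
    · simpa using h2.symm
    rintro v ⟨-, h3, h4⟩
    rw [Equiv.eq_symm_apply]
    exact adj_unique (e.injective.ne hne) h3.2.2.symm h4.2.2.symm h1 h2

/-- If `u` lay below one of the three intersections, it would be one of its sides, hence too low to
lie above another intersection and so a side of that one as well; but the sides are distinct. So `u`
lies above all three, and since a node has only two elements below it, two of the intersections
coincide, again contradicting distinctness. -/
theorem not_collinear_of_diagonal {p q r p' q' r' : A} (hne : [p, q, r, p', q', r'].Nodup)
    (u : FTerm A)
    (hx : C.tadj (mkNode (mkNode (base p) (base q)) (mkNode (base p') (base q'))) u)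
    (hy : C.tadj (mkNode (mkNode (base p) (base r)) (mkNode (base p') (base r'))) u)
    (hz : C.tadj (mkNode (mkNode (base q) (base r)) (mkNode (base q') (base r'))) u) : False := by
  have inj : ∀ {a b c d : A}, mkNode (base a) (base b) = mkNode (base c) (base d) →
      (a = c ∧ b = d) ∨ (a = d ∧ b = c) := fun h => by simpa using mkNode_inj h
  simp only [List.nodup_cons, List.mem_cons, not_or, List.not_mem_nil, not_false_eq_true,
    List.nodup_nil, and_true] at hne
  have low : ∀ {a b a' b' c d c' d' : A},
      C.lo (mkNode (mkNode (base a) (base b)) (mkNode (base a') (base b'))) u →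
      C.tadj (mkNode (mkNode (base c) (base d)) (mkNode (base c') (base d'))) u →
      (mkNode (base a) (base b) = mkNode (base c) (base d) ∨
        mkNode (base a) (base b) = mkNode (base c') (base d')) ∨
      (mkNode (base a') (base b') = mkNode (base c) (base d) ∨
        mkNode (base a') (base b') = mkNode (base c') (base d')) := by
    intro a b a' b' c d c' d' h h'
    have : ¬ C.lo u (mkNode (mkNode (base c) (base d)) (mkNode (base c') (base d'))) := by
      rcases lo_mkNode.1 h with rfl | rfl <;> exact lo_mkNode_mkNode_base
    have h' := lo_mkNode.1 (h'.resolve_right this)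
    rcases lo_mkNode.1 h with rfl | rfl
    · exact .inl h'
    · exact .inr h'
  have hx' := hx.resolve_left fun h => by
    rcases low h hy with (h | h) | (h | h) <;> have := inj h <;> grind
  have hy' := hy.resolve_left fun h => by
    rcases low h hz with (h | h) | (h | h) <;> have := inj h <;> grind
  have hz' := hz.resolve_left fun h => by
    rcases low h hx with (h | h) | (h | h) <;> have := inj h <;> grind
  rcases u with a | ⟨s, t⟩
  · exact hx'
  · have e : ∀ {x y : FTerm A}, C.lo (node s t) (mkNode x y) →
        mkNode x y = s ∨ mkNode x y = t := fun h => h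
    have e2 : ∀ {a b a' b' c d c' d' : A},
        mkNode (mkNode (base a) (base b)) (mkNode (base a') (base b')) =
          mkNode (mkNode (base c) (base d)) (mkNode (base c') (base d')) →
        mkNode (base a) (base b) = mkNode (base c) (base d) ∨
          mkNode (base a) (base b) = mkNode (base c') (base d') := by
      intro a b a' b' c d c' d' h
      rcases mkNode_inj h with h | h
      · exact .inl h.1
      · exact .inr h.1
    rcases e hx' with h1 | h1 <;> rcases e hy' with h2 | h2 <;> rcases e hz' with h3 | h3
    all_goals first
      | (rcases e2 (h1.trans h2.symm) with h | h <;> have := inj h <;> grind)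
      | (rcases e2 (h1.trans h3.symm) with h | h <;> have := inj h <;> grind)
      | (rcases e2 (h2.trans h3.symm) with h | h <;> have := inj h <;> grind)

/-- Desargues' condition fails if there are two triangles in perspective all whose sides are added
in the free completion. -/
theorem not_isDesarguesian_planeOn {D : Type*} (e : D ≃ C.Free) {o p q r p' q' r' a b c : A}
    (hne : [p, q, r, p', q', r'].Nodup)
    (hcol : ∀ x ∈ [o, p, q, r, p', q', r'], C.col x = true)
    (hpa : C.adj p a) (hpa' : C.adj p' a) (hqb : C.adj q b) (hqb' : C.adj q' b)
    (hrc : C.adj r c) (hrc' : C.adj r' c) (hoa : C.adj o a) (hob : C.adj o b) (hoc : C.adj o c)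
    (hpq : ¬ ∃ u, C.adj p u ∧ C.adj q u) (hpq' : ¬ ∃ u, C.adj p' u ∧ C.adj q' u)
    (hpr : ¬ ∃ u, C.adj p u ∧ C.adj r u) (hpr' : ¬ ∃ u, C.adj p' u ∧ C.adj r' u)
    (hqr : ¬ ∃ u, C.adj q u ∧ C.adj r u) (hqr' : ¬ ∃ u, C.adj q' u ∧ C.adj r' u) :
    ¬ (planeOn e).IsDesarguesian := by
  have hn := hne
  simp only [List.nodup_cons, List.mem_cons, not_or, List.not_mem_nil, not_false_eq_true,
    List.nodup_nil, and_true] at hn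
  simp only [List.mem_cons, List.not_mem_nil, or_false, forall_eq_or_imp, forall_eq] at hcol
  obtain ⟨co, cp, cq, cr, cp', cq', cr'⟩ := hcol
  have inc_base : ∀ {x l : A}, C.col x = true → C.adj x l →
      (planeOn e).inc (e.symm (ofBase C x)) (e.symm (ofBase C l)) := by
    intro x l hx h
    have hl := C.col_ne h
    rw [hx] at hl
    refine ⟨?_, ?_, ?_⟩
    · simpa [ofBase_color] using hx
    · simpa [ofBase_color] using hl.symm
    · simpa using adj_ofBase.2 h
  have side : ∀ {x y : A}, x ≠ y → C.col x = true → C.col y = true →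
      (¬ ∃ u, C.adj x u ∧ C.adj y u) → ∃ l : C.Free, l.1 = mkNode (base x) (base y) ∧
        l.color = false ∧ (planeOn e).inc (e.symm (ofBase C x)) (e.symm l) ∧
        (planeOn e).inc (e.symm (ofBase C y)) (e.symm l) := by
    intro x y hxy hx hy h
    have hj : ¬ C.Joined (ofBase C x).1 (ofBase C y).1 := fun h' => h h'.of_base
    have hne : ofBase C x ≠ ofBase C y := ofBase_injective.ne hxy
    have hc : (ofBase C x).color = (ofBase C y).color := hx.trans hy.symm
    have hl : (join _ _ hne hc hj).color = false := by
      have := (adj_join_left _ _ hne hc hj).color_ne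
      rw [ofBase_color, hx] at this
      simpa using this.symm
    refine ⟨join _ _ hne hc hj, rfl, hl, ⟨?_, ?_, ?_⟩, ⟨?_, ?_, ?_⟩⟩
    · simpa [ofBase_color] using hx
    · simpa using hl
    · simpa using adj_join_left _ _ hne hc hj
    · simpa [ofBase_color] using hy
    · simpa using hl
    · simpa using adj_join_right _ _ hne hc hj
  have diag : ∀ {x y x' y' : A} {l m : C.Free}, x ≠ x' ∧ x ≠ y' ∧ y ≠ x' ∧ y ≠ y' →
      l.1 = mkNode (base x) (base y) → m.1 = mkNode (base x') (base y') →
      l.color = false → m.color = false → l ≠ m ∧ ∃ z : C.Free,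
        z.1 = mkNode (mkNode (base x) (base y)) (mkNode (base x') (base y')) ∧
        (planeOn e).inc (e.symm z) (e.symm l) ∧ (planeOn e).inc (e.symm z) (e.symm m) := by
    intro x y x' y' l m hd hl hm hcl hcm
    have hj : ¬ C.Joined l.1 m.1 := by rw [hl, hm]; exact not_joined_mkNode hd
    have hlm : l ≠ m := by
      rintro rfl
      rw [hl] at hm
      have := mkNode_inj hm
      simp only [base.injEq] at this
      tauto
    have hc : l.color = m.color := hcl.trans hcm.symm
    have hz : (join _ _ hlm hc hj).color = true := by
      have := (adj_join_left _ _ hlm hc hj).color_ne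
      rw [hcl] at this
      simpa using this.symm
    refine ⟨hlm, join _ _ hlm hc hj, by rw [← hl, ← hm]; rfl, ⟨?_, ?_, ?_⟩, ⟨?_, ?_, ?_⟩⟩
    · simpa using hz
    · simpa using hcl
    · simpa using (adj_join_left _ _ hlm hc hj).symm
    · simpa using hz
    · simpa using hcm
    · simpa using (adj_join_right _ _ hlm hc hj).symm
  have ne : ∀ {x y : A}, x ≠ y → e.symm (ofBase C x) ≠ e.symm (ofBase C y) :=
    fun h => e.symm.injective.ne (ofBase_injective.ne h)
  obtain ⟨lpq, e1, k1, i1, j1⟩ := side (by tauto) cp cq hpq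
  obtain ⟨lpq', e1', k1', i1', j1'⟩ := side (by tauto) cp' cq' hpq'
  obtain ⟨lpr, e2, k2, i2, j2⟩ := side (by tauto) cp cr hpr
  obtain ⟨lpr', e2', k2', i2', j2'⟩ := side (by tauto) cp' cr' hpr'
  obtain ⟨lqr, e3, k3, i3, j3⟩ := side (by tauto) cq cr hqr
  obtain ⟨lqr', e3', k3', i3', j3'⟩ := side (by tauto) cq' cr' hqr'
  obtain ⟨n1, x, hx, x1, x2⟩ := diag (by tauto) e1 e1' k1 k1'
  obtain ⟨n2, y, hy, y1, y2⟩ := diag (by tauto) e2 e2' k2 k2'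
  obtain ⟨n3, z, hz, z1, z2⟩ := diag (by tauto) e3 e3' k3 k3'
  intro h
  obtain ⟨u, -, ⟨-, -, h1⟩, ⟨-, -, h2⟩, -, -, h3⟩ := h _ _ _ _ _ _
    (ne (by tauto : p ≠ q)) (ne (by tauto : p ≠ r)) (ne (by tauto : q ≠ r))
    (ne (by tauto : p' ≠ q')) (ne (by tauto : p' ≠ r')) (ne (by tauto : q' ≠ r'))
    (ne (by tauto)) (ne (by tauto)) (ne (by tauto))
    _ _ _ _ (inc_base cp hpa) (inc_base cp' hpa') (inc_base cq hqb) (inc_base cq' hqb')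
    (inc_base cr hrc) (inc_base cr' hrc') (inc_base co hoa) (inc_base co hob) (inc_base co hoc)
    _ _ _ _ _ _ i1 j1 i1' j1' (e.symm.injective.ne n1) i2 j2 i2' j2' (e.symm.injective.ne n2)
    i3 j3 i3' j3' (e.symm.injective.ne n3) _ _ _ x1 x2 y1 y2 z1 z2
  rw [Equiv.apply_symm_apply] at h1 h2 h3
  unfold Adj at h1 h2 h3
  rw [hx] at h1
  rw [hy] at h2
  rw [hz] at h3
  exact not_collinear_of_diagonal hne _ h1 h2 h3

theorem isIso_planeOn_iff {D D' : Type*} (e : D ≃ C.Free) (e' : D' ≃ C'.Free) (φ : D ≃ D') :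
    IncStr.IsIso (planeOn e) (planeOn e') φ ↔ IsIso C C' ((e.symm.trans φ).trans e') := by
  constructor
  · intro h
    have hcol : ∀ x, ((e.symm.trans φ).trans e' x).color = x.color := by
      intro x
      have h1 := h.pt_iff (e.symm x)
      simp only [planeOn, Equiv.apply_symm_apply] at h1
      exact Bool.eq_iff_iff.2 h1
    have key : ∀ x y : C.Free, x.color = true → y.color = false →
        (((e.symm.trans φ).trans e' x).Adj ((e.symm.trans φ).trans e' y) ↔ x.Adj y) := by
      intro x y hx hy
      have h1 := h.inc_iff (e.symm x) (e.symm y)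
      have h2 := hcol x
      have h3 := hcol y
      simp only [Equiv.trans_apply] at h2 h3
      simpa [planeOn, h2, h3, hx, hy] using h1
    refine ⟨hcol, fun x y => ?_⟩
    have comm : ∀ x y : C.Free, x.Adj y ↔ y.Adj x := fun x y => ⟨Adj.symm, Adj.symm⟩
    have comm' : ∀ x y : C'.Free, x.Adj y ↔ y.Adj x := fun x y => ⟨Adj.symm, Adj.symm⟩
    by_cases hxy : x.color = y.color
    · refine iff_of_false (fun h => h.color_ne ?_) fun h => h.color_ne hxy
      rw [hcol, hcol, hxy]
    · cases hx : x.color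
      · rw [comm', comm]
        exact key y x (Bool.eq_true_of_not_eq_false fun hy => hxy (hx.trans hy.symm)) hx
      · exact key x y hx (Bool.eq_false_of_not_eq_true fun hy => hxy (hx.trans hy.symm))
  · intro h
    have h1 : ∀ x, (e' (φ x)).color = (e x).color := fun x => by
      simpa using h.color_map (e x)
    have h2 : ∀ x y, (e' (φ x)).Adj (e' (φ y)) ↔ (e x).Adj (e y) := fun x y => by
      simpa using h.adj_map (e x) (e y)
    exact ⟨fun x => by simp [planeOn, h1], fun x => by simp [planeOn, h1],
      fun x y => by simp [planeOn, h1, h2]⟩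

end Configuration

namespace Configuration

open FTerm Elt Free graphConfig

variable {V W : Type u}

theorem exists_three [Infinite V] : ∃ v w t : V, v ≠ w ∧ v ≠ t ∧ w ≠ t := by
  classical
  obtain ⟨T, -, hT⟩ := Infinite.exists_superset_card_eq (∅ : Finset V) 3 (by simp)
  obtain ⟨v, w, t, h1, h2, h3, -⟩ := Finset.card_eq_three.1 hT
  exact ⟨v, w, t, h1, h2, h3⟩

theorem no_common_neighbor {Γ : SimpleGraph V} {x y : Elt V}
    (h : ∀ u, (Inc Γ x u ∨ Inc Γ u x) → (Inc Γ y u ∨ Inc Γ u y) → False) :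
    ¬ ∃ u, (graphConfig Γ).adj x u ∧ (graphConfig Γ).adj y u :=
  fun ⟨u, h1, h2⟩ => h u h1 h2

theorem isProjectivePlane_graph [Infinite V] {D : Type*} (Γ : SimpleGraph V)
    (e : D ≃ (graphConfig Γ).Free) : (planeOn e).IsProjectivePlane := by
  obtain ⟨v, w, t, h1, h2, h3⟩ := exists_three (V := V)
  refine isProjectivePlane_planeOn e (inConfined Γ) (p := vert v 0) (q := vert w 0)
    (r := vert t 0) (by simpa) (by simpa using h2.symm) (by simpa using h3.symm) rfl rfl rfl
    (no_common_neighbor ?_)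
  rintro (⟨u, k⟩ | ⟨u, u', hu, k⟩ | ⟨u, u', hu, k⟩) h h' <;>
    simp only [Inc, false_or] at h h' <;> grind

theorem not_isDesarguesian_graph [Infinite V] {D : Type*} (Γ : SimpleGraph V)
    (e : D ≃ (graphConfig Γ).Free) : ¬ (planeOn e).IsDesarguesian := by
  obtain ⟨v, w, t, h1, h2, h3⟩ := exists_three (V := V)
  obtain ⟨i, hi, hadj⟩ := exists_adj_ln (Γ := Γ) v w h1 false
  -- The centre is a point with exactly three lines `vert v 5`, `vert w 1`, `ln v w h1 false`. On
  -- each, two further points are picked so that no two in the same triangle share a line; `i` is 0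
  -- or 2 according to adjacency of `v` and `w`.
  refine not_isDesarguesian_planeOn e (o := pt v w h1 false)
    (p := pt v t h2 false) (q := vert w 0) (r := vert w 4)
    (p' := vert v 6) (q' := pt t w h3.symm false) (r' := vert v i)
    (a := vert v 5) (b := vert w 1) (c := ln v w h1 false)
    ?_ ?_ ?_ ?_ ?_ ?_ ?_ ?_ ?_ ?_ ?_ ?_ ?_ ?_ ?_ ?_ ?_
  · rcases hi with rfl | rfl <;> simp [h1.symm, h2]
  · rcases hi with rfl | rfl <;> simp [graphConfig, Elt.col]
  · exact adj_pt_left v t h2 false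
  · exact adj_vert_vert.2 ⟨rfl, .inr rfl⟩
  · exact adj_vert_vert.2 ⟨rfl, .inl rfl⟩
  · exact adj_pt_right t w h3.symm false
  · exact (graphConfig Γ).symm (adj_ln_right v w h1 false)
  · exact (graphConfig Γ).symm hadj
  · exact adj_pt_left v w h1 false
  · exact adj_pt_right v w h1 false
  · exact adj_pt_ln v w h1 false
  all_goals
    refine no_common_neighbor ?_
    rintro (⟨u, k⟩ | ⟨u, u', hu, k⟩ | ⟨u, u', hu, k⟩) h h' <;>
      simp only [Inc, or_false, false_or] at h h' <;> grind [Bool.toNat]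

/-! ### Isomorphisms of graphs and of planes -/

section Lift

variable {Γ : SimpleGraph V} {Γ' : SimpleGraph W} {D D' : Type u}

/-- The isomorphism between planes induced by an isomorphism of graphs. -/
noncomputable def lift (e : D ≃ (graphConfig Γ).Free) (e' : D' ≃ (graphConfig Γ').Free)
    (σ : Γ ≃g Γ') : D ≃ D' :=
  (e.trans (ext (isoOf σ))).trans e'.symm

theorem lift_conj (e : D ≃ (graphConfig Γ).Free) (e' : D' ≃ (graphConfig Γ').Free)
    (σ : Γ ≃g Γ') : (e.symm.trans (lift e e' σ)).trans e' = ext (isoOf σ) := by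
  ext x; simp [lift]

theorem isIso_lift (e : D ≃ (graphConfig Γ).Free) (e' : D' ≃ (graphConfig Γ').Free)
    (σ : Γ ≃g Γ') : IncStr.IsIso (planeOn e) (planeOn e') (lift e e' σ) := by
  rw [isIso_planeOn_iff, lift_conj]
  exact isIso_ext _

/-- The two recovery steps combined: plane to configuration, then configuration to graph. It gives
both surjectivity onto the automorphism group and the reflection of isomorphism. -/
theorem exists_eq_lift [Infinite V] [Infinite W] (e : D ≃ (graphConfig Γ).Free)
    (e' : D' ≃ (graphConfig Γ').Free) {φ : D ≃ D'}
    (h : IncStr.IsIso (planeOn e) (planeOn e') φ) : ∃ σ, lift e e' σ = φ := by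
  rw [isIso_planeOn_iff] at h
  obtain ⟨f, hf⟩ := h.exists_eq_ext (inConfined Γ) (inConfined Γ')
  obtain ⟨σ, hσ⟩ := exists_eq_isoOf f
  refine ⟨σ, ?_⟩
  have h1 : ext (isoOf σ) = (e.symm.trans φ).trans e' := by
    refine (isIso_ext _).ext_of_base h fun a => ?_
    rw [hf, ext_ofBase, ext_ofBase, hσ]
  unfold lift
  rw [h1]
  ext x; simp

theorem lift_injective (e : D ≃ (graphConfig Γ).Free) (e' : D' ≃ (graphConfig Γ').Free) :
    Function.Injective (lift e e') := by
  intro σ τ h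
  have h1 : ext (isoOf σ) = ext (isoOf τ) := by rw [← lift_conj e e', h, lift_conj]
  ext v
  have h2 := congrArg (fun g => g (ofBase _ (vert v 0))) h1
  simp only [ext_ofBase] at h2
  have h3 := ofBase_injective h2
  simpa [isoOf, Elt.map] using h3

theorem lift_mul (e : D ≃ (graphConfig Γ).Free) (σ τ : Γ ≃g Γ) :
    lift e e (σ * τ) = lift e e σ * lift e e τ := by
  have h1 : ext (isoOf (σ * τ)) = (ext (isoOf τ)).trans (ext (isoOf σ)) := by
    refine (isIso_ext _).ext_of_base ((isIso_ext _).trans (isIso_ext _)) fun a => ?_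
    rw [Equiv.trans_apply, ext_ofBase, ext_ofBase, ext_ofBase]
    congr 1
    cases a <;> rfl
  unfold lift
  rw [h1]
  ext x; simp

theorem nonempty_aut_mulEquiv [Infinite V] (e : D ≃ (graphConfig Γ).Free) :
    Nonempty ((Γ ≃g Γ) ≃* (planeOn e).Aut) := by
  let F : (Γ ≃g Γ) →* (planeOn e).Aut :=
    MonoidHom.mk' (fun σ => ⟨lift e e σ, isIso_lift e e σ⟩)
      fun σ τ => Subtype.ext (lift_mul e σ τ)
  refine ⟨MulEquiv.ofBijective F ⟨fun σ τ h => lift_injective e e (congrArg Subtype.val h), ?_⟩⟩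
  rintro ⟨φ, hφ⟩
  obtain ⟨σ, hσ⟩ := exists_eq_lift e e hφ
  exact ⟨σ, Subtype.ext hσ⟩

end Lift

open Cardinal in
theorem mk_free [Infinite V] (Γ : SimpleGraph V) : #(graphConfig Γ).Free = #V := by
  refine le_antisymm ?_ ?_
  · exact (mk_subtype_le _).trans (FTerm.cardinal_le.trans Elt.cardinal_le)
  · exact mk_le_of_injective (f := fun v => ofBase _ (vert v 0)) fun v w h => by
      simpa using ofBase_injective h

open Cardinal in
theorem mk_points [Infinite V] (Γ : SimpleGraph V) (e : V ≃ (graphConfig Γ).Free) :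
    #{x : V // (planeOn e).pt x} = #V := by
  refine le_antisymm (mk_subtype_le _) (mk_le_of_injective
    (f := fun v => ⟨e.symm (ofBase _ (vert v 0)), ?_⟩) fun v w h => ?_)
  · simp only [planeOn, Equiv.apply_symm_apply]
    rfl
  · have := e.symm.injective (congrArg Subtype.val h)
    simpa using ofBase_injective this

end Configuration

/-! ### Borel enumeration and the Borel property of the map -/

section Enumeration

variable {Ω α : Type*} [MeasurableSpace Ω]

theorem measurableSet_count (p : Ω → ℕ → Prop) [∀ ω, DecidablePred (p ω)]
    (hp : ∀ n, MeasurableSet {ω | p ω n}) (n k : ℕ) :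
    MeasurableSet {ω | Nat.count (p ω) n = k} := by
  induction n generalizing k with
  | zero => simp
  | succ n ih =>
    have : {ω | Nat.count (p ω) (n + 1) = k} =
        ({ω | p ω n} ∩ ⋃ j, {ω | Nat.count (p ω) n = j ∧ j + 1 = k}) ∪
        ({ω | p ω n}ᶜ ∩ {ω | Nat.count (p ω) n = k}) := by
      ext ω
      by_cases h : p ω n <;> simp [Nat.count_succ, h]
    rw [this]
    refine ((hp n).inter (.iUnion fun j => ?_)).union ((hp n).compl.inter (ih k))
    by_cases hj : j + 1 = k <;> simp [hj, ih]

/-- Measurable families of infinite subsets of a countable set have a measurable enumeration. -/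
theorem exists_measurable_enumeration {V : Type*} [Countable α] [Infinite V] [Countable V]
    (p : Ω → α → Prop) (hp : ∀ a, MeasurableSet {ω | p ω a})
    (hinf : ∀ ω, Infinite {a // p ω a}) :
    ∃ e : ∀ ω, V ≃ {a // p ω a}, ∀ v a, MeasurableSet {ω | (e ω v).1 = a} := by
  classical
  rcases isEmpty_or_nonempty Ω with hΩ | ⟨⟨ω₀⟩⟩
  · exact ⟨fun ω => isEmptyElim ω, fun v a => by
      rw [Set.eq_empty_of_isEmpty {ω : Ω | _}]; exact .empty⟩
  have : Infinite α := .of_injective (Subtype.val : {a // p ω₀ a} → α) Subtype.val_injective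
  obtain ⟨E⟩ : Nonempty (α ≃ ℕ) := nonempty_equiv_of_countable
  obtain ⟨N⟩ : Nonempty (V ≃ ℕ) := nonempty_equiv_of_countable
  let q : Ω → ℕ → Prop := fun ω n => p ω (E.symm n)
  have hq : ∀ ω, {n | q ω n}.Infinite := fun ω => by
    refine Set.infinite_of_injective_forall_mem (f := fun x : {a // p ω a} => E x.1)
      (fun x y h => Subtype.ext (E.injective h)) fun x => ?_
    change p ω (E.symm (E x.1))
    simpa using x.2
  let e : ∀ ω, V ≃ {a // p ω a} := fun ω => Equiv.ofBijective
    (fun v => ⟨E.symm (Nat.nth (q ω) (N v)), Nat.nth_mem_of_infinite (hq ω) _⟩) (by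
      constructor
      · intro v w h
        have := E.symm.injective (congrArg Subtype.val h)
        exact N.injective (Nat.nth_injective (hq ω) this)
      · rintro ⟨a, ha⟩
        have ha' : q ω (E a) := by simpa [q] using ha
        refine ⟨N.symm (Nat.count (q ω) (E a)), Subtype.ext ?_⟩
        simp [Nat.nth_count ha'])
  refine ⟨e, fun v a => ?_⟩
  -- An element is the one with index `N v` exactly when it belongs to the subset and exactly `N v`
  -- members precede it.
  have : {ω | (e ω v).1 = a} = {ω | p ω a} ∩ {ω | Nat.count (q ω) (E a) = N v} := by
    ext ω
    have h0 : (e ω v).1 = E.symm (Nat.nth (q ω) (N v)) := rfl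
    simp only [Set.mem_ofPred_eq, Set.mem_inter_iff, h0, Equiv.symm_apply_eq]
    constructor
    · intro h
      refine ⟨?_, ?_⟩
      · have := Nat.nth_mem_of_infinite (hq ω) (N v)
        rw [h] at this
        simpa [q] using this
      · rw [← h, Nat.count_nth_of_infinite (hq ω)]
    · rintro ⟨h1, h2⟩
      have ha' : q ω (E a) := by simpa [q] using h1
      rw [← h2, Nat.nth_count ha']
  rw [this]
  exact (hp a).inter (measurableSet_count q (fun n => hp _) _ _)

end Enumeration

namespace Configuration

open FTerm Elt Free graphConfig

section Borel

variable {V : Type u}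

/-- The Borel sets of graphs. -/
@[reducible] def graphBorel (V : Type u) : MeasurableSpace (SimpleGraph V) :=
  @borel _ (graphTopology V)

attribute [local instance] graphBorel

theorem measurableSet_adj (v w : V) : MeasurableSet {Γ : SimpleGraph V | Γ.Adj v w} :=
  MeasurableSpace.measurableSet_generateFrom
    (TopologicalSpace.isOpen_generateFrom_of_mem ⟨v, w, .inl rfl⟩)

theorem measurableSet_inc (x y : Elt V) : MeasurableSet {Γ : SimpleGraph V | Inc Γ x y} := by
  rcases x with ⟨a, i⟩ | ⟨a, a', ha, i⟩ | ⟨a, a', ha, i⟩ <;>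
  rcases y with ⟨b, j⟩ | ⟨b, b', hb, j⟩ | ⟨b, b', hb, j⟩
  case ln.vert =>
    have h := measurableSet_adj a a'
    have h' : MeasurableSet {Γ : SimpleGraph V | i = true ↔ Γ.Adj a a'} := by
      cases i
      · convert h.compl using 1
        ext; simp
      · simpa using h
    exact (((MeasurableSet.const _).inter (((MeasurableSet.const _).inter h').union
      ((MeasurableSet.const _).inter h'.compl))).union (MeasurableSet.const _))
  all_goals exact MeasurableSet.const _

theorem measurableSet_lo (x y : FTerm (Elt V)) :
    MeasurableSet {Γ : SimpleGraph V | (graphConfig Γ).lo x y} := by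
  rcases x with a | ⟨s, t⟩
  · rcases y with b | ⟨s', t'⟩
    · exact (measurableSet_inc a b).union (measurableSet_inc b a)
    · exact MeasurableSet.const _
  · exact MeasurableSet.const _

theorem measurableSet_tadj (x y : FTerm (Elt V)) :
    MeasurableSet {Γ : SimpleGraph V | (graphConfig Γ).tadj x y} :=
  (measurableSet_lo x y).union (measurableSet_lo y x)

/-- The graph influences incidence only, never the colours of the base elements. -/
theorem tcol_graphConfig (Γ Γ' : SimpleGraph V) (x : FTerm (Elt V)) :
    (graphConfig Γ).tcol x = (graphConfig Γ').tcol x := by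
  induction x with
  | base a => rfl
  | node s t ihs _ => simp only [tcol, ihs]

theorem measurableSet_tcol (x : FTerm (Elt V)) (b : Bool) :
    MeasurableSet {Γ : SimpleGraph V | (graphConfig Γ).tcol x = b} := by
  simp only [tcol_graphConfig _ (⊥ : SimpleGraph V) x]
  exact MeasurableSet.const _

variable [Infinite V] [Countable V]

instance : Countable (FTerm (Elt V)) :=
  Cardinal.mk_le_aleph0_iff.1 ((FTerm.cardinal_le.trans Elt.cardinal_le).trans Cardinal.mk_le_aleph0)

theorem measurableSet_joined (s t : FTerm (Elt V)) :
    MeasurableSet {Γ : SimpleGraph V | (graphConfig Γ).Joined s t} := by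
  unfold Joined
  simp only [Set.ofPred_exists]
  refine .iUnion fun u => ?_
  exact ((measurableSet_lo s u).inter (measurableSet_lo t u)).union
    (((measurableSet_lo t u).inter (measurableSet_lo u s)).union
      ((measurableSet_lo s u).inter (measurableSet_lo u t)))

theorem measurableSet_valid (x : FTerm (Elt V)) :
    MeasurableSet {Γ : SimpleGraph V | (graphConfig Γ).Valid x} := by
  induction x with
  | base a => exact MeasurableSet.const True
  | node s t ihs iht =>
    have h : MeasurableSet {Γ : SimpleGraph V |
        (graphConfig Γ).tcol s = (graphConfig Γ).tcol t} := by
      simp only [tcol_graphConfig _ (⊥ : SimpleGraph V)]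
      exact MeasurableSet.const _
    exact ihs.inter (iht.inter ((MeasurableSet.const _).inter (h.inter
      ((MeasurableSet.const _).inter (measurableSet_joined s t).compl))))

theorem isBorelMap_planeOn (e : ∀ Γ : SimpleGraph V, V ≃ (graphConfig Γ).Free)
    (he : ∀ v x, MeasurableSet {Γ | (e Γ v).1 = x}) :
    IsBorelMap fun Γ : SimpleGraph V => planeOn (e Γ) := by
  unfold IsBorelMap
  let _ := IncStr.structTopology V
  have hcol : ∀ v b, MeasurableSet {Γ : SimpleGraph V | (e Γ v).color = b} := by
    intro v b
    have : {Γ : SimpleGraph V | (e Γ v).color = b} =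
        ⋃ x, {Γ | (e Γ v).1 = x} ∩ {Γ | (graphConfig Γ).tcol x = b} := by
      ext Γ
      simp [color]
    rw [this]
    exact .iUnion fun x => (he v x).inter (measurableSet_tcol x b)
  have hadj : ∀ v w, MeasurableSet {Γ : SimpleGraph V | (e Γ v).Adj (e Γ w)} := by
    intro v w
    have : {Γ : SimpleGraph V | (e Γ v).Adj (e Γ w)} =
        ⋃ x, ⋃ y, {Γ | (e Γ v).1 = x} ∩ ({Γ | (e Γ w).1 = y} ∩
          {Γ | (graphConfig Γ).tadj x y}) := by
      ext Γ
      simp [Adj]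
    rw [this]
    exact .iUnion fun x => .iUnion fun y =>
      (he v x).inter ((he w y).inter (measurableSet_tadj x y))
  have hinc : ∀ v w, MeasurableSet {Γ : SimpleGraph V | (planeOn (e Γ)).inc v w} :=
    fun v w => (hcol v true).inter ((hcol w false).inter (hadj v w))
  -- With a countable subbasis the Borel sets are generated by the atomic conditions, so only their
  -- preimages need checking.
  have : SecondCountableTopology (IncStr V) := by
    refine ⟨⟨_, ?_, rfl⟩⟩
    refine .union (.union ?_ ?_) ?_
    · refine ((Set.countable_range fun x => {S : IncStr V | S.pt x}).union
        (Set.countable_range fun x => {S : IncStr V | ¬ S.pt x})).mono ?_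
      rintro U ⟨x, rfl | rfl⟩
      exacts [.inl ⟨x, rfl⟩, .inr ⟨x, rfl⟩]
    · refine ((Set.countable_range fun x => {S : IncStr V | S.ln x}).union
        (Set.countable_range fun x => {S : IncStr V | ¬ S.ln x})).mono ?_
      rintro U ⟨x, rfl | rfl⟩
      exacts [.inl ⟨x, rfl⟩, .inr ⟨x, rfl⟩]
    · refine ((Set.countable_range fun x : V × V => {S : IncStr V | S.inc x.1 x.2}).union
        (Set.countable_range fun x : V × V => {S : IncStr V | ¬ S.inc x.1 x.2})).mono ?_
      rintro U ⟨x, y, rfl | rfl⟩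
      exacts [.inl ⟨(x, y), rfl⟩, .inr ⟨(x, y), rfl⟩]
  rw [borel_eq_generateFrom_of_subbasis (t := IncStr.structTopology V) rfl]
  refine measurable_generateFrom ?_
  rintro U ((⟨x, rfl | rfl⟩ | ⟨x, rfl | rfl⟩) | ⟨x, y, rfl | rfl⟩)
  exacts [hcol x true, (hcol x true).compl, hcol x false, (hcol x false).compl, hinc x y,
    (hinc x y).compl]

end Borel

/-- An enumeration of the free completions of the configurations of the graphs on `V` by the
elements of `V`, which is Borel if `V` is countable. -/
theorem exists_enumeration (V : Type u) [Infinite V] :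
    ∃ e : ∀ Γ : SimpleGraph V, V ≃ (graphConfig Γ).Free,
      Countable V → ∀ v x, @MeasurableSet _ (graphBorel V) {Γ | (e Γ v).1 = x} := by
  by_cases hV : Countable V
  · obtain ⟨e, he⟩ := @exists_measurable_enumeration _ (FTerm (Elt V)) (graphBorel V) V _ _ _
      (fun Γ x => (graphConfig Γ).Valid x) measurableSet_valid fun Γ =>
        (Cardinal.infinite_iff.2 (by
          have := mk_free Γ
          unfold Free at this
          rw [this]
          exact Cardinal.aleph0_le_mk V))
    exact ⟨e, fun _ => he⟩
  -- Nothing Borel is required for uncountable `V`, so equality of cardinals is enough.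
  · have : ∀ Γ : SimpleGraph V, Nonempty (V ≃ (graphConfig Γ).Free) := fun Γ =>
      Cardinal.eq.1 (mk_free Γ).symm
    exact ⟨fun Γ => (this Γ).some, fun h => (hV h).elim⟩

end Configuration

open Configuration in
theorem theorem2 :
    ∃ P : ∀ (V : Type u) [Infinite V], SimpleGraph V → IncStr V,
      (∀ (V : Type u) [Infinite V] (Γ : SimpleGraph V),
        (P V Γ).IsProjectivePlane ∧
        Cardinal.mk {x : V // (P V Γ).pt x} = Cardinal.mk V ∧
        ¬ (P V Γ).IsDesarguesian ∧
        Nonempty ((Γ ≃g Γ) ≃* (P V Γ).Aut)) ∧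
      (∀ (V W : Type u) [Infinite V] [Infinite W] (Γ₁ : SimpleGraph V) (Γ₂ : SimpleGraph W),
        Nonempty (Γ₁ ≃g Γ₂) ↔ (P V Γ₁).Isomorphic (P W Γ₂)) ∧
      (∀ (V : Type u) [Infinite V] [Countable V], IsBorelMap (fun Γ : SimpleGraph V => P V Γ)) := by
  choose e he using exists_enumeration.{u}
  refine ⟨fun V _ Γ => planeOn (e V Γ), fun V _ Γ => ⟨isProjectivePlane_graph Γ _,
    mk_points Γ _, not_isDesarguesian_graph Γ _, nonempty_aut_mulEquiv _⟩, ?_, ?_⟩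
  · intro V W _ _ Γ₁ Γ₂
    constructor
    · rintro ⟨σ⟩
      exact ⟨_, isIso_lift _ _ σ⟩
    · rintro ⟨φ, hφ⟩
      obtain ⟨σ, -⟩ := exists_eq_lift _ _ hφ
      exact ⟨σ⟩
  · intro V _ hV
    exact isBorelMap_planeOn (e V) (he V hV)
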